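/- Let $\mathcal X,\mathcal Y$ be finite alphabets and let $W_1,W_2$ be two discrete memoryless channels from $\mathcal X$ to $\mathcal Y$. Fix a distribution $Q_0$ on $\mathcal Y$ which is the common output marginal of two non-deterministic input distributions, i.e. there are distributions $P_1,P_2$ on $\mathcal X$, neither of them a point mass, with $\sum_x P_s(x)W_s(y|x)=Q_0(y)$ for all $y$ and $s=1,2$. Let $\mathcal P$ be the set of all pairs $(P_1,P_2)$ of distributions on $\mathcal X$ with $\sum_x P_1(x)W_1(y|x)=\sum_x P_2(x)W_2(y|x)=Q_0(y)$ for all $y$. Logarithms are to base 2. A code of blocklength $n$ with non-empty finite message set $\mathcal M$ and key set $\mathcal K$ consists of encoders $f_s:\mathcal M\times\mathcal K\to\mathcal X^n$ and decoders $g_s:\mathcal Y^n\times\mathcal K\to\mathcal M$, $s=1,2$. The message and key are independent and uniform; $Q_s^n$ denotes the distribution of the output $Y^n$ when $f_s(M,K)$ is sent over $W_s^{n}$, and $P_{\rm e}$ is the maximum over $s$, $k\in\mathcal K$, $m\in\mathcal M$ of $\Pr(g_s(Y^n,K)\ne M\mid K=k,M=m)$ in state $s$. For $\epsilon,\delta_1,\delta_2>0$,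 $L\in[0,\infty)$ and $L_K\in[0,\infty]$, call $(L,L_K)$ $(\epsilon,\delta_1,\delta_2)$-achievable if for every $n$ there is a code $(\mathcal M_n,\mathcal K_n)$ of blocklength $n$ with $P_{\rm e}\le\epsilon$ and $D(Q_s^n\|Q_0^{\times n})\le\delta_s$ for $s=1,2$, such that $\liminf_n \frac1n\log|\mathcal M_n|\ge L$ and $\limsup_n\frac1n\log|\mathcal K_n|\le L_K$. Let $L_1^*(\epsilon,\delta_1,\delta_2)$ be the supremum of all $L$ such that $(L,\infty)$ is achievable (a key of unlimited length), and $L_1^*(0^+,\delta_1,\delta_2)=\lim_{\epsilon\downarrow0}L_1^*(\epsilon,\delta_1,\delta_2)$. Then for all $\delta_1,\delta_2>0$ the limit exists and $$L_1^*(0^+,\delta_1,\delta_2)=\min_{s\in\{1,2\}}\ \max_{(P_1,P_2)\in\mathcal P} I(P_s,W_s),$$ where the maxima are attained. The same holds if $L_1^*(\epsilon,\delta_1,\delta_2)$ is replaced by the supremum of all $L$ such that $(L,L_K)$ is achievable for some finite $L_K$. Moreover a positive rate is achievable, i.e. there is $L>0$ such that $(L,\infty)$ is $(\epsilon,\delta_1,\delta_2)$-achievable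 for every $\epsilon>0$, if and only if there is a pair $(P_1,P_2)\in\mathcal P$ such that for each $s\in\{1,2\}$ the output distributions $W_s(\cdot|x)$, $x\in\operatorname{supp}P_s$, are not all equal. -/

import Mathlib

namespace CompoundCovert

open Filter

noncomputable section

variable {X Y : Type*} [Fintype X] [Fintype Y]

/-- Output marginal of a single-letter channel `V` (rows `V x`) under the input distribution `P`. -/
def outDist (P : X → ℝ) (V : X → Y → ℝ) (y : Y) : ℝ :=
  ∑ x, P x * V x y

/-- Mutual information `I(P, V)` in bits. -/
def mutualInfo (P : X → ℝ) (V : X → Y → ℝ) : ℝ :=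
  ∑ x, ∑ y, P x * V x y * Real.logb 2 (V x y / outDist P V y)

open Classical in
/-- Kullback-Leibler divergence in bits between two pmfs on a finite set; it is `⊤` when the first
is not absolutely continuous with respect to the second. -/
def klDivergence {Z : Type*} [Fintype Z] (P Q : Z → ℝ) : EReal :=
  if ∀ z, Q z = 0 → P z = 0 then ((∑ z, P z * Real.logb 2 (P z / Q z) : ℝ) : EReal) else ⊤

/-- The `n`-fold product distribution. -/
def prodDist {Z : Type*} (Q : Z → ℝ) (n : ℕ) (z : Fin n → Z) : ℝ :=
  ∏ i, Q (z i)

/-- The `n`-fold memoryless extension of a channel. -/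
def prodChannel (V : X → Y → ℝ) (n : ℕ) (x : Fin n → X) (y : Fin n → Y) : ℝ :=
  ∏ i, V (x i) (y i)

/-- Pairs of input distributions (one for each state) which induce the common output
marginal `Q₀` through their respective channels. -/
def maskingPairs (W : Fin 2 → X → Y → ℝ) (Q₀ : Y → ℝ) : Set (Fin 2 → X → ℝ) :=
  {P | (∀ s, P s ∈ stdSimplex ℝ X) ∧ ∀ s y, outDist (P s) (W s) y = Q₀ y}

/-- `Q₀` is the common output marginal of two non-deterministic input distributions. -/
def IsCase1 (W : Fin 2 → X → Y → ℝ) (Q₀ : Y → ℝ) : Prop :=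
  ∃ P ∈ maskingPairs W Q₀, ∀ s, ¬ ∃ x, P s x = 1

/-- A code of blocklength `n` with message set `Fin M`, key set `Fin K`, and state-dependent
encoders and decoders. -/
structure Code (X Y : Type*) (n M K : ℕ) where
  enc : Fin 2 → Fin M → Fin K → (Fin n → X)
  dec : Fin 2 → (Fin n → Y) → Fin K → Fin M

/-- Distribution of the channel output in state `s`, for message and key independent and uniform. -/
def Code.output {n M K : ℕ} (c : Code X Y n M K) (W : Fin 2 → X → Y → ℝ) (s : Fin 2)
    (y : Fin n → Y) : ℝ :=
  (1 / ((M : ℝ) * (K : ℝ))) * ∑ m, ∑ k, prodChannel (W s) n (c.enc s m k) y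

open Classical in
/-- Probability of a decoding error given state `s`, key `k` and message `m`. -/
def Code.errorProb {n M K : ℕ} (c : Code X Y n M K) (W : Fin 2 → X → Y → ℝ) (s : Fin 2)
    (k : Fin K) (m : Fin M) : ℝ :=
  ∑ y : Fin n → Y, if c.dec s y k ≠ m then prodChannel (W s) n (c.enc s m k) y else 0

/-- The maximum error probability (over states, keys and messages) is at most `ε`, and in each
state `s` the divergence of the output distribution from `Q₀ⁿ` is at most `δ s`. -/
def Code.IsKLCode {n M K : ℕ} (c : Code X Y n M K) (W : Fin 2 → X → Y → ℝ) (Q₀ : Y → ℝ)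
    (ε : ℝ) (δ : Fin 2 → ℝ) : Prop :=
  (∀ s k m, c.errorProb W s k m ≤ ε) ∧
    ∀ s, klDivergence (c.output W s) (prodDist Q₀ n) ≤ (δ s : EReal)

/-- `(ε, δ, ζ)`-achievability of the pair `(L, LK)` of message and key throughputs. The value
`LK = ⊤` puts no restriction on the key sizes. -/
def IsAchievable (W : Fin 2 → X → Y → ℝ) (Q₀ : Y → ℝ) (ζ ε : ℝ) (δ : Fin 2 → ℝ)
    (L : ℝ) (LK : EReal) : Prop :=
  ∃ (M K : ℕ → ℕ) (c : ∀ n, Code X Y n (M n) (K n)),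
    (∀ n, 0 < M n ∧ 0 < K n ∧ (c n).IsKLCode W Q₀ ε δ) ∧
    (L : EReal) ≤ liminf (fun n : ℕ => ((Real.logb 2 (M n) / (n : ℝ) ^ ζ : ℝ) : EReal)) atTop ∧
    limsup (fun n : ℕ => ((Real.logb 2 (K n) / (n : ℝ) ^ ζ : ℝ) : EReal)) atTop ≤ LK

/-- Optimal throughput when arbitrarily long keys are available (`LK = ∞`). -/
def optThroughputInfKey (W : Fin 2 → X → Y → ℝ) (Q₀ : Y → ℝ) (ζ ε : ℝ) (δ : Fin 2 → ℝ) : EReal :=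
  sSup {l : EReal | ∃ L : ℝ, 0 ≤ L ∧ l = (L : EReal) ∧ IsAchievable W Q₀ ζ ε δ L ⊤}

/-- Optimal throughput over all finite key throughputs `LK`. -/
def optThroughput (W : Fin 2 → X → Y → ℝ) (Q₀ : Y → ℝ) (ζ ε : ℝ) (δ : Fin 2 → ℝ) : EReal :=
  sSup {l : EReal | ∃ L LK : ℝ, 0 ≤ L ∧ 0 ≤ LK ∧ l = (L : EReal) ∧
    IsAchievable W Q₀ ζ ε δ L (LK : EReal)}

end

end CompoundCovert

/-!
Achievability. Greedy selection with a threshold test on the information density places a codebook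
of any rate below `I(P, W)`, with small *maximal* error, inside every set of inputs of mass at
least `γ`. The keys are added one at a time: by Markov's inequality, the inputs whose output
correlates with the sum of the earlier codebook outputs at most `1 / (1 - γ)` times as strongly as
`Q₀ⁿ` does have mass at least `γ`, and the next codebook is taken from among them. After `K` keys
the second moment of the likelihood ratio of the output with respect to `Q₀ⁿ` is at most
`1 / (1 - γ) + 1 / (βⁿ K)`, where `β` is the least positive value of `Q₀`, and its logarithm bounds
the divergence. A key of linear length therefore suffices.

Converse. Comparing the code with `Q₀ⁿ` bounds `(1 - ε) log |M|` by one plus the average divergence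
of the codeword outputs from `Q₀ⁿ`; this is linear in the empirical distribution of all code
letters. By the Donsker-Varadhan inequality, bounded output divergence forces every limit point of
these empirical distributions to induce exactly `Q₀`.
-/

namespace CompoundCovert

open Filter
open scoped Topology BigOperators

section RelativeEntropy

variable {Z : Type*} [Fintype Z] {p q : Z → ℝ}

/-- Kullback-Leibler divergence in nats, with real values: it is meant for `p` absolutely
continuous with respect to `q`, whereas `klDivergence` is in bits and takes the value `⊤`
otherwise. -/
noncomputable def relEntropy (p q : Z → ℝ) : ℝ :=
  ∑ z, p z * Real.log (p z / q z)

theorem klDivergence_le_coe_iff {δ : ℝ} :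
    klDivergence p q ≤ (δ : EReal) ↔
      (∀ z, q z = 0 → p z = 0) ∧ relEntropy p q ≤ δ * Real.log 2 := by
  have hbits : ∑ z, p z * Real.logb 2 (p z / q z) = relEntropy p q / Real.log 2 := by
    simp only [relEntropy, Real.logb, Finset.sum_div, mul_div_assoc]
  rw [klDivergence]
  split_ifs with hpq
  · rw [EReal.coe_le_coe_iff, hbits, div_le_iff₀ (Real.log_pos one_lt_two)]
    exact ⟨fun h => ⟨hpq, h⟩, fun h => h.2⟩
  · simp [hpq]

theorem relEntropy_eq_sum_mul_klFun (hp : ∑ z, p z = 1) (hq : ∑ z, q z = 1)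
    (hpq : ∀ z, q z = 0 → p z = 0) :
    relEntropy p q = ∑ z, q z * InformationTheory.klFun (p z / q z) := by
  have hterm : ∀ z, q z * InformationTheory.klFun (p z / q z) =
      p z * Real.log (p z / q z) + (q z - p z) := fun z => by
    rcases eq_or_ne (q z) 0 with hz | hz
    · simp [hz, hpq z hz]
    · rw [InformationTheory.klFun_apply]
      field_simp
      ring
  simp [hterm, Finset.sum_add_distrib, hp, hq, relEntropy]

theorem relEntropy_nonneg (hp : p ∈ stdSimplex ℝ Z) (hq : q ∈ stdSimplex ℝ Z)
    (hpq : ∀ z, q z = 0 → p z = 0) : 0 ≤ relEntropy p q := by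
  rw [relEntropy_eq_sum_mul_klFun hp.2 hq.2 hpq]
  exact Finset.sum_nonneg fun z _ => mul_nonneg (hq.1 z)
    (InformationTheory.klFun_nonneg (div_nonneg (hp.1 z) (hq.1 z)))

theorem relEntropy_eq_zero_iff (hp : p ∈ stdSimplex ℝ Z) (hq : q ∈ stdSimplex ℝ Z)
    (hpq : ∀ z, q z = 0 → p z = 0) : relEntropy p q = 0 ↔ p = q := by
  have hratio : ∀ z, 0 ≤ p z / q z := fun z => div_nonneg (hp.1 z) (hq.1 z)
  rw [relEntropy_eq_sum_mul_klFun hp.2 hq.2 hpq, Finset.sum_eq_zero_iff_of_nonneg fun z _ =>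
    mul_nonneg (hq.1 z) (InformationTheory.klFun_nonneg (hratio z)), funext_iff]
  refine forall_congr' fun z => ?_
  rcases eq_or_ne (q z) 0 with hz | hz
  · simp [hz, hpq z hz]
  · simp [hz, InformationTheory.klFun_eq_zero_iff (hratio z), div_eq_one_iff_eq hz]

theorem sum_mul_pos (hp : p ∈ stdSimplex ℝ Z) {f : Z → ℝ} (hf : ∀ z, p z ≠ 0 → 0 < f z) :
    0 < ∑ z, p z * f z := by
  have hterm : ∀ z, p z ≠ 0 → 0 < p z * f z := fun z hz =>
    mul_pos ((hp.1 z).lt_of_ne' hz) (hf z hz)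
  obtain ⟨z, -, hz⟩ := Finset.exists_ne_zero_of_sum_ne_zero (hp.2 ▸ one_ne_zero)
  refine Finset.sum_pos' (fun w _ => ?_) ⟨z, Finset.mem_univ z, hterm z hz⟩
  rcases eq_or_ne (p w) 0 with hw | hw
  · simp [hw]
  · exact (hterm w hw).le

theorem sum_mul_log_le_log_sum_mul (hp : p ∈ stdSimplex ℝ Z) {f : Z → ℝ}
    (hf : ∀ z, p z ≠ 0 → 0 < f z) :
    ∑ z, p z * Real.log (f z) ≤ Real.log (∑ z, p z * f z) := by
  have hSpos := sum_mul_pos hp hf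
  set S := ∑ z, p z * f z with hS
  have htangent : ∀ z,
      p z * Real.log (f z) ≤ p z * Real.log S + (p z * f z / S - p z) := fun z => by
    rcases eq_or_ne (p z) 0 with hz | hz
    · simp [hz]
    · have h := mul_le_mul_of_nonneg_left
        (Real.log_le_sub_one_of_pos (div_pos (hf z hz) hSpos)) (hp.1 z)
      rw [Real.log_div (hf z hz).ne' hSpos.ne'] at h
      linarith [mul_div_assoc (p z) (f z) S]
  calc ∑ z, p z * Real.log (f z)
      ≤ ∑ z, (p z * Real.log S + (p z * f z / S - p z)) := Finset.sum_le_sum fun z _ => htangent z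
    _ = Real.log S := by
        rw [Finset.sum_add_distrib, Finset.sum_sub_distrib, ← Finset.sum_mul, ← Finset.sum_div,
          ← hS, hp.2, div_self hSpos.ne']
        ring

theorem sum_mul_le_relEntropy_add_log_sum_mul_exp (hp : p ∈ stdSimplex ℝ Z)
    (hq : ∀ z, 0 ≤ q z) (hpq : ∀ z, q z = 0 → p z = 0) (g : Z → ℝ) :
    ∑ z, p z * g z ≤ relEntropy p q + Real.log (∑ z, q z * Real.exp (g z)) := by
  have hpos : ∀ z, p z ≠ 0 → 0 < q z / p z := fun z hz =>
    div_pos ((hq z).lt_of_ne' (mt (hpq z) hz)) ((hp.1 z).lt_of_ne' hz)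
  have hpos_exp : ∀ z, p z ≠ 0 → 0 < q z / p z * Real.exp (g z) := fun z hz =>
    mul_pos (hpos z hz) (Real.exp_pos _)
  have hjensen := sum_mul_log_le_log_sum_mul hp hpos_exp
  have hlog : ∀ z, p z * Real.log (q z / p z * Real.exp (g z)) =
      p z * g z - p z * Real.log (p z / q z) := fun z => by
    rcases eq_or_ne (p z) 0 with hz | hz
    · simp [hz]
    · rw [Real.log_mul (hpos z hz).ne' (Real.exp_pos _).ne', Real.log_exp, ← inv_div,
        Real.log_inv]
      ring
  have hmass : ∑ z, p z * (q z / p z * Real.exp (g z)) ≤ ∑ z, q z * Real.exp (g z) := by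
    refine Finset.sum_le_sum fun z _ => ?_
    rcases eq_or_ne (p z) 0 with hz | hz
    · simpa [hz] using mul_nonneg (hq z) (Real.exp_pos _).le
    · exact (by field_simp : p z * (q z / p z * Real.exp (g z)) = q z * Real.exp (g z)).le
  rw [Finset.sum_congr rfl fun z _ => hlog z, Finset.sum_sub_distrib] at hjensen
  rw [relEntropy]
  linarith [Real.log_le_log (sum_mul_pos hp hpos_exp) hmass]

theorem relEntropy_le_log_of_sum_sq_div_le (hp : p ∈ stdSimplex ℝ Z) (hq : ∀ z, 0 ≤ q z)
    (hpq : ∀ z, q z = 0 → p z = 0) {c : ℝ} (hc : ∑ z, p z ^ 2 / q z ≤ c) :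
    relEntropy p q ≤ Real.log c := by
  have hpos : ∀ z, p z ≠ 0 → 0 < p z / q z := fun z hz =>
    div_pos ((hp.1 z).lt_of_ne' hz) ((hq z).lt_of_ne' (mt (hpq z) hz))
  have hsq : ∑ z, p z * (p z / q z) ≤ c := by simpa only [← mul_div_assoc, ← sq] using hc
  exact (sum_mul_log_le_log_sum_mul hp hpos).trans (Real.log_le_log (sum_mul_pos hp hpos) hsq)

open Classical in
theorem sum_mul_le_relEntropy_add_sum_mul_exp (hp : p ∈ stdSimplex ℝ Z) (hq : q ∈ stdSimplex ℝ Z)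
    (hpq : ∀ z, q z = 0 → p z = 0) (E : Finset Z) (t : ℝ) :
    (∑ z ∈ E, p z) * t ≤ relEntropy p q + (∑ z ∈ E, q z) * Real.exp t := by
  have hmean : ∑ z, p z * (if z ∈ E then t else 0) = (∑ z ∈ E, p z) * t := by
    simp [Finset.sum_mul]
  have hexp : ∑ z, q z * Real.exp (if z ∈ E then t else 0) ≤ 1 + (∑ z ∈ E, q z) * Real.exp t := by
    calc ∑ z, q z * Real.exp (if z ∈ E then t else 0)
        ≤ ∑ z, (q z + if z ∈ E then q z * Real.exp t else 0) := by
          refine Finset.sum_le_sum fun z _ => ?_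
          have := hq.1 z
          split_ifs <;> simp [this]
      _ = 1 + (∑ z ∈ E, q z) * Real.exp t := by
          simp [Finset.sum_add_distrib, Finset.sum_mul, hq.2]
  have hvar := sum_mul_le_relEntropy_add_log_sum_mul_exp hp hq.1 hpq fun z => if z ∈ E then t else 0
  rw [hmean] at hvar
  linarith [Real.log_le_sub_one_of_pos (sum_mul_pos hq fun z _ =>
    Real.exp_pos (if z ∈ E then t else 0))]

/- Equality holds at `f = 0`, so the first variation there vanishes, and it is `q - p`. -/
theorem eq_of_forall_sum_mul_le_log_sum_mul_exp (hq : ∑ z, q z = 1)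
    (h : ∀ f : Z → ℝ, ∑ z, p z * f z ≤ Real.log (∑ z, q z * Real.exp (f z))) : p = q := by
  classical
  funext z
  let F : ℝ → ℝ := fun t => Real.log (1 + q z * (Real.exp t - 1)) - p z * t
  have hF : ∀ t, 0 ≤ F t := fun t => by
    have hexp : ∀ w, q w * Real.exp (if w = z then t else 0) =
        q w + if w = z then q w * (Real.exp t - 1) else 0 := fun w => by
      split_ifs <;> simp [mul_sub]
    have hvar := h fun w => if w = z then t else 0
    simp only [hexp, Finset.sum_add_distrib, hq, mul_ite, mul_zero, Finset.sum_ite_eq',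
      Finset.mem_univ, if_true] at hvar
    exact sub_nonneg.mpr hvar
  have hmin : IsLocalMin F 0 := Eventually.of_forall fun t => by simpa [F] using hF t
  have hderiv : HasDerivAt F (q z - p z) 0 := by
    have hexp := (((Real.hasDerivAt_exp 0).sub_const 1).const_mul (q z)).const_add 1
    exact ((hexp.log (by simp)).sub ((hasDerivAt_id (0 : ℝ)).const_mul (p z))).congr_deriv
      (by simp)
  linarith [hmin.hasDerivAt_eq_zero hderiv]

end RelativeEntropy

section Product

variable {ι Z : Type*} [Fintype ι] [Fintype Z] {p q : ι → Z → ℝ}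

theorem eq_zero_of_pi_prod_eq_zero (hp : ∀ i, p i ∈ stdSimplex ℝ Z)
    (hpq : ∀ z : ι → Z, ∏ i, q i (z i) = 0 → ∏ i, p i (z i) = 0) (i : ι) (z : Z)
    (hz : q i z = 0) : p i z = 0 := by
  classical
  have hsupp : ∀ j, ∃ w, p j w ≠ 0 := fun j => by
    obtain ⟨w, -, hw⟩ := Finset.exists_ne_zero_of_sum_ne_zero ((hp j).2 ▸ one_ne_zero)
    exact ⟨w, hw⟩
  choose w hw using hsupp
  have hprod := hpq (Function.update w i z)
    (Finset.prod_eq_zero (Finset.mem_univ i) (by simpa using hz))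
  obtain ⟨j, -, hj⟩ := Finset.prod_eq_zero_iff.mp hprod
  rcases eq_or_ne j i with rfl | hji
  · simpa using hj
  · exact absurd (by simpa [hji] using hj) (hw j)

variable [DecidableEq ι]

theorem pi_prod_mem_stdSimplex (hp : ∀ i, p i ∈ stdSimplex ℝ Z) :
    (fun z : ι → Z => ∏ i, p i (z i)) ∈ stdSimplex ℝ (ι → Z) :=
  ⟨fun z => Finset.prod_nonneg fun i _ => (hp i).1 (z i), by
    rw [← Fintype.prod_sum]
    exact Finset.prod_eq_one fun i _ => (hp i).2⟩

theorem sum_pi_prod_mul_sum (hp : ∀ i, ∑ z, p i z = 1) (f : ι → Z → ℝ) :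
    ∑ z : ι → Z, (∏ i, p i (z i)) * ∑ i, f i (z i) = ∑ i, ∑ z, p i z * f i z := by
  simp only [Finset.mul_sum]
  rw [Finset.sum_comm]
  refine Finset.sum_congr rfl fun i _ => ?_
  have hfactor : ∀ z : ι → Z, (∏ j, p j (z j)) * f i (z i) =
      ∏ j, p j (z j) * (if j = i then f i (z j) else 1) := fun z => by
    rw [Finset.prod_mul_distrib, Finset.prod_ite_eq' Finset.univ i]
    simp
  rw [Finset.sum_congr rfl fun z _ => hfactor z,
    ← Fintype.prod_sum fun j z => p j z * if j = i then f i z else 1,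
    Finset.prod_eq_single i (fun j _ hj => by simp [hj, hp j]) (by simp)]
  simp

theorem relEntropy_pi_prod (hp : ∀ i, p i ∈ stdSimplex ℝ Z)
    (hpq : ∀ i z, q i z = 0 → p i z = 0) :
    relEntropy (fun z : ι → Z => ∏ i, p i (z i)) (fun z => ∏ i, q i (z i)) =
      ∑ i, relEntropy (p i) (q i) := by
  simp only [relEntropy]
  rw [← sum_pi_prod_mul_sum (fun i => (hp i).2) fun i z => Real.log (p i z / q i z)]
  refine Finset.sum_congr rfl fun z _ => ?_
  by_cases hz : ∀ i, p i (z i) ≠ 0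
  · rw [← Finset.prod_div_distrib,
      Real.log_prod fun i _ => div_ne_zero (hz i) (mt (hpq i (z i)) (hz i))]
  · obtain ⟨i, hi⟩ := not_forall_not.mp hz
    rw [Finset.prod_eq_zero (f := fun i => p i (z i)) (Finset.mem_univ i) hi, zero_mul, zero_mul]

end Product

section Channel

variable {A B : Type*} {P : A → ℝ} {V : A → B → ℝ}

theorem prodDist_mem_stdSimplex [Fintype B] {Q : B → ℝ} (hQ : Q ∈ stdSimplex ℝ B) (n : ℕ) :
    prodDist Q n ∈ stdSimplex ℝ (Fin n → B) :=
  pi_prod_mem_stdSimplex fun _ => hQ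

theorem prodChannel_mem_stdSimplex [Fintype B] (hV : ∀ a, V a ∈ stdSimplex ℝ B) (n : ℕ)
    (x : Fin n → A) : prodChannel V n x ∈ stdSimplex ℝ (Fin n → B) :=
  pi_prod_mem_stdSimplex fun i => hV (x i)

theorem pow_le_prodDist {Q : B → ℝ} {β : ℝ} (hβ : 0 ≤ β) (hQ : ∀ b, Q b ≠ 0 → β ≤ Q b) (n : ℕ)
    (y : Fin n → B) (hy : prodDist Q n y ≠ 0) : β ^ n ≤ prodDist Q n y := by
  calc β ^ n = ∏ _i : Fin n, β := by simp
    _ ≤ prodDist Q n y := Finset.prod_le_prod (fun _ _ => hβ) fun i _ =>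
        hQ _ (Finset.prod_ne_zero_iff.mp hy i (Finset.mem_univ i))

variable [Fintype A]

theorem outDist_nonneg (hP : ∀ a, 0 ≤ P a) (hV : ∀ a b, 0 ≤ V a b) (b : B) :
    0 ≤ outDist P V b :=
  Finset.sum_nonneg fun a _ => mul_nonneg (hP a) (hV a b)

theorem outDist_mem_stdSimplex [Fintype B] (hP : P ∈ stdSimplex ℝ A)
    (hV : ∀ a, V a ∈ stdSimplex ℝ B) : outDist P V ∈ stdSimplex ℝ B := by
  refine ⟨outDist_nonneg hP.1 fun a => (hV a).1, ?_⟩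
  unfold outDist
  rw [Finset.sum_comm]
  simp only [← Finset.mul_sum, (hV _).2, mul_one, hP.2]

theorem eq_zero_of_outDist_eq_zero (hP : ∀ a, 0 ≤ P a) (hV : ∀ a b, 0 ≤ V a b) {a : A}
    (ha : P a ≠ 0) {b : B} (hb : outDist P V b = 0) : V a b = 0 := by
  have hterm := (Finset.sum_eq_zero_iff_of_nonneg fun a _ => mul_nonneg (hP a) (hV a b)).mp hb a
    (Finset.mem_univ a)
  exact (mul_eq_zero.mp hterm).resolve_left ha

theorem div_outDist_pos (hP : ∀ a, 0 ≤ P a) (hV : ∀ a b, 0 ≤ V a b) {a : A} {b : B}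
    (hab : P a * V a b ≠ 0) : 0 < V a b / outDist P V b := by
  obtain ⟨ha, hb⟩ := mul_ne_zero_iff.mp hab
  exact div_pos ((hV a b).lt_of_ne' hb)
    ((outDist_nonneg hP hV b).lt_of_ne' fun h => hb (eq_zero_of_outDist_eq_zero hP hV ha h))

theorem sum_mul_sum_eq_sum_outDist_mul [Fintype B] (P : A → ℝ) (V : A → B → ℝ) (f : B → ℝ) :
    ∑ a, P a * ∑ b, V a b * f b = ∑ b, outDist P V b * f b := by
  simp only [outDist, Finset.mul_sum, Finset.sum_mul, mul_assoc]
  exact Finset.sum_comm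

theorem outDist_prodDist_prodChannel (P : A → ℝ) (V : A → B → ℝ) (n : ℕ) :
    outDist (prodDist P n) (prodChannel V n) = prodDist (outDist P V) n := by
  funext y
  simp only [outDist, prodDist, prodChannel, ← Finset.prod_mul_distrib]
  exact (Fintype.prod_sum fun i x => P x * V x (y i)).symm

end Channel

section Feinstein

variable {A B ι : Type*} [Fintype B] {V : A → B → ℝ} {p : A → ℝ} {q : B → ℝ} {ε θ : ℝ}

open Classical in
/-- The codebook `c` with decoder `d` has maximal error probability at most `ε` over the
channel `V`. -/
def HasMaxError (V : A → B → ℝ) (ε : ℝ) (c : ι → A) (d : B → ι) : Prop :=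
  ∀ m, ∑ b with d b ≠ m, V (c m) b ≤ ε

open Classical in
/-- The outputs at which the information density of the input `a`, relative to the output
distribution `q`, exceeds `log θ`; written as a product so that zeros of `q` need no convention. -/
noncomputable def thresholdSet (V : A → B → ℝ) (q : B → ℝ) (θ : ℝ) (a : A) : Finset B :=
  {b | θ * q b < V a b}

theorem sum_thresholdSet_le (hV : ∀ a, V a ∈ stdSimplex ℝ B) (hθ : 0 < θ) (a : A) :
    ∑ b ∈ thresholdSet V q θ a, q b ≤ 1 / θ := by
  rw [le_div_iff₀' hθ, Finset.mul_sum]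
  calc ∑ b ∈ thresholdSet V q θ a, θ * q b
      ≤ ∑ b ∈ thresholdSet V q θ a, V a b :=
        Finset.sum_le_sum fun b hb => (Finset.mem_filter.mp hb).2.le
    _ ≤ ∑ b, V a b := Finset.sum_le_univ_sum_of_nonneg (hV a).1
    _ = 1 := (hV a).2

open Classical in
theorem exists_mem_sum_compl_sdiff_le [Fintype A] (hV : ∀ a b, 0 ≤ V a b) (hp : ∀ a, 0 ≤ p a)
    (T : A → Finset B) {E : Finset B} {S : Finset A}
    (hS : ∑ a, p a * ∑ b ∈ (T a)ᶜ, V a b + ∑ b ∈ E, outDist p V b < ε * ∑ a ∈ S, p a) :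
    ∃ a ∈ S, ∑ b ∈ (T a \ E)ᶜ, V a b ≤ ε := by
  by_contra! hfail
  have hunion : ∀ a, ∑ b ∈ (T a \ E)ᶜ, V a b ≤ ∑ b ∈ (T a)ᶜ, V a b + ∑ b ∈ E, V a b := fun a => by
    rw [← Finset.sum_union_inter]
    have hcompl : (T a \ E)ᶜ = (T a)ᶜ ∪ E := by ext b; simp; tauto
    rw [hcompl]
    exact le_add_of_nonneg_right (Finset.sum_nonneg fun b _ => hV a b)
  have hmass : ∑ a, p a * ∑ b ∈ E, V a b = ∑ b ∈ E, outDist p V b := by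
    simp only [Finset.mul_sum, outDist]
    exact Finset.sum_comm
  refine hS.not_ge ?_
  calc ε * ∑ a ∈ S, p a
      ≤ ∑ a ∈ S, p a * (∑ b ∈ (T a)ᶜ, V a b + ∑ b ∈ E, V a b) := by
        rw [Finset.mul_sum]
        refine Finset.sum_le_sum fun a ha => ?_
        rw [mul_comm]
        exact mul_le_mul_of_nonneg_left ((hfail a ha).le.trans (hunion a)) (hp a)
    _ ≤ ∑ a, p a * (∑ b ∈ (T a)ᶜ, V a b + ∑ b ∈ E, V a b) :=
        Finset.sum_le_univ_sum_of_nonneg fun a => mul_nonneg (hp a)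
          (add_nonneg (Finset.sum_nonneg fun b _ => hV a b) (Finset.sum_nonneg fun b _ => hV a b))
    _ = ∑ a, p a * ∑ b ∈ (T a)ᶜ, V a b + ∑ b ∈ E, outDist p V b := by
        simp only [mul_add, Finset.sum_add_distrib, hmass]

open Classical in
theorem exists_disjoint_decodingSets [Fintype A] (hV : ∀ a, V a ∈ stdSimplex ℝ B)
    (hp : ∀ a, 0 ≤ p a) (hθ : 0 < θ) {S : Finset A} (M : ℕ)
    (hM : ∑ a, p a * ∑ b ∈ (thresholdSet V (outDist p V) θ a)ᶜ, V a b + (M - 1) / θ <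
      ε * ∑ a ∈ S, p a) :
    ∃ (c : Fin M → A) (D : Fin M → Finset B), Pairwise (Function.onFun Disjoint D) ∧
      ∀ m, c m ∈ S ∧ D m ⊆ thresholdSet V (outDist p V) θ (c m) ∧
        ∑ b ∈ (D m)ᶜ, V (c m) b ≤ ε := by
  induction M with
  | zero => exact ⟨Fin.elim0, Fin.elim0, fun i => i.elim0, fun i => i.elim0⟩
  | succ M ih =>
    have hstep : ((M : ℝ) - 1) / θ ≤ ((M + 1 : ℕ) - 1) / θ := by
      gcongr
      exact Nat.le_succ M
    obtain ⟨c, D, hD, hc⟩ := ih (by linarith)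
    have hused : ∑ b ∈ Finset.univ.biUnion D, outDist p V b ≤ M / θ := by
      calc ∑ b ∈ Finset.univ.biUnion D, outDist p V b
          ≤ ∑ m, ∑ b ∈ D m, outDist p V b :=
            (Finset.sum_biUnion fun i _ j _ hij => hD hij).le
        _ ≤ ∑ _m : Fin M, 1 / θ := Finset.sum_le_sum fun m _ =>
            (Finset.sum_le_sum_of_subset_of_nonneg (hc m).2.1 fun b _ _ =>
              outDist_nonneg hp (fun a => (hV a).1) b).trans
              (sum_thresholdSet_le hV hθ (c m))
        _ = M / θ := by simp [div_eq_mul_inv]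
    obtain ⟨a, haS, ha⟩ := exists_mem_sum_compl_sdiff_le (fun a => (hV a).1) hp
      (thresholdSet V (outDist p V) θ) (E := Finset.univ.biUnion D) (S := S) (ε := ε) (by
        push_cast at hM
        rw [add_sub_cancel_right] at hM
        linarith)
    have hnew : ∀ m, Disjoint (thresholdSet V (outDist p V) θ a \ Finset.univ.biUnion D) (D m) :=
      fun m => Finset.sdiff_disjoint.mono_right (Finset.subset_biUnion_of_mem D (Finset.mem_univ m))
    refine ⟨Fin.cons a c, Fin.cons (thresholdSet V (outDist p V) θ a \ Finset.univ.biUnion D) D,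
      ?_, ?_⟩
    · intro i j hij
      induction i using Fin.cases <;> induction j using Fin.cases
      · exact absurd rfl hij
      · exact hnew _
      · exact (hnew _).symm
      · exact hD fun h => hij (congrArg Fin.succ h)
    · exact Fin.forall_fin_succ.mpr ⟨⟨haS, Finset.sdiff_subset, ha⟩, hc⟩

open Classical in
theorem exists_decoder [Nonempty ι] (hV : ∀ a b, 0 ≤ V a b) {c : ι → A} {D : ι → Finset B}
    (hD : Pairwise (Function.onFun Disjoint D)) (hc : ∀ m, ∑ b ∈ (D m)ᶜ, V (c m) b ≤ ε) :
    ∃ d : B → ι, HasMaxError V ε c d := by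
  have hdec : ∀ b, ∃ m, ∀ m', b ∈ D m' → m = m' := fun b => by
    by_cases hb : ∃ m, b ∈ D m
    · obtain ⟨m, hm⟩ := hb
      exact ⟨m, fun m' hm' => by_contra fun hne => Finset.disjoint_left.mp (hD hne) hm hm'⟩
    · exact ⟨Classical.arbitrary ι, fun m' hm' => absurd ⟨m', hm'⟩ hb⟩
  choose d hd using hdec
  refine ⟨d, fun m => (Finset.sum_le_sum_of_subset_of_nonneg (fun b hb => ?_) fun b _ _ =>
    hV (c m) b).trans (hc m)⟩
  exact Finset.mem_compl.mpr fun hbm => (Finset.mem_filter.mp hb).2 (hd b m hbm)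

open Classical in
theorem exists_codebook_of_thresholdSet [Fintype A] (hV : ∀ a, V a ∈ stdSimplex ℝ B)
    (hp : ∀ a, 0 ≤ p a) (hθ : 0 < θ) {S : Finset A} {M : ℕ} (hM : 0 < M)
    (hS : ∑ a, p a * ∑ b ∈ (thresholdSet V (outDist p V) θ a)ᶜ, V a b + (M - 1) / θ <
      ε * ∑ a ∈ S, p a) :
    ∃ (c : Fin M → A) (d : B → Fin M), (∀ m, c m ∈ S) ∧ HasMaxError V ε c d := by
  obtain ⟨c, D, hD, hc⟩ := exists_disjoint_decodingSets hV hp hθ M hS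
  have : Nonempty (Fin M) := ⟨⟨0, hM⟩⟩
  obtain ⟨d, hd⟩ := exists_decoder (fun a => (hV a).1) hD fun m => (hc m).2.2
  exact ⟨c, d, fun m => (hc m).1, hd⟩

end Feinstein

section InformationDensity

variable {A B : Type*} [Fintype A] [Fintype B] {P : A → ℝ} {V : A → B → ℝ}

theorem mutualInfo_mul_log_two (P : A → ℝ) (V : A → B → ℝ) :
    mutualInfo P V * Real.log 2 = ∑ a, P a * relEntropy (V a) (outDist P V) := by
  have hlog : Real.log 2 ≠ 0 := (Real.log_pos one_lt_two).ne'
  simp only [mutualInfo, relEntropy, Real.logb, Finset.sum_mul, Finset.mul_sum, mul_assoc,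
    div_mul_cancel₀ _ hlog]

/-- The moment generating function, evaluated at `-t`, of the information density between input
and output of the channel `V` with input distribution `P`. -/
noncomputable def infoMoment (P : A → ℝ) (V : A → B → ℝ) (t : ℝ) : ℝ :=
  ∑ a, ∑ b, P a * V a b * (V a b / outDist P V b) ^ (-t)

theorem infoMoment_nonneg (hP : ∀ a, 0 ≤ P a) (hV : ∀ a b, 0 ≤ V a b) (t : ℝ) :
    0 ≤ infoMoment P V t :=
  Finset.sum_nonneg fun a _ => Finset.sum_nonneg fun b _ => mul_nonneg (mul_nonneg (hP a) (hV a b))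
    (Real.rpow_nonneg (div_nonneg (hV a b) (outDist_nonneg hP hV b)) _)

open Classical in
theorem sum_compl_thresholdSet_le (hP : ∀ a, 0 ≤ P a) (hV : ∀ a b, 0 ≤ V a b) {θ t : ℝ}
    (hθ : 0 < θ) (ht : 0 ≤ t) :
    ∑ a, P a * ∑ b ∈ (thresholdSet V (outDist P V) θ a)ᶜ, V a b ≤ θ ^ t * infoMoment P V t := by
  have hterm : ∀ a b, 0 ≤ θ ^ t * (P a * V a b * (V a b / outDist P V b) ^ (-t)) := fun a b => by
    rcases eq_or_ne (P a * V a b) 0 with hab | hab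
    · simp [hab]
    · exact mul_nonneg (Real.rpow_nonneg hθ.le t) (mul_nonneg (mul_nonneg (hP a) (hV a b))
        (Real.rpow_nonneg (div_outDist_pos hP hV hab).le _))
  have hmarkov : ∀ a b, b ∉ thresholdSet V (outDist P V) θ a →
      P a * V a b ≤ θ ^ t * (P a * V a b * (V a b / outDist P V b) ^ (-t)) := fun a b hb => by
    rcases eq_or_ne (P a * V a b) 0 with hab | hab
    · simp [hab]
    have hratio := div_outDist_pos hP hV hab
    have hle : V a b / outDist P V b ≤ θ := by
      have hq : 0 < outDist P V b :=
        (div_pos_iff_of_pos_left ((hV a b).lt_of_ne' (mul_ne_zero_iff.mp hab).2)).mp hratio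
      rw [div_le_iff₀ hq]
      exact not_lt.mp fun h => hb (Finset.mem_filter.mpr ⟨Finset.mem_univ b, h⟩)
    rw [mul_left_comm]
    refine le_mul_of_one_le_right (mul_nonneg (hP a) (hV a b)) ?_
    rw [Real.rpow_neg hratio.le, ← div_eq_mul_inv, ← Real.div_rpow hθ.le hratio.le]
    exact Real.one_le_rpow ((one_le_div hratio).mpr hle) ht
  simp only [infoMoment, Finset.mul_sum]
  exact Finset.sum_le_sum fun a _ => (Finset.sum_le_sum fun b hb =>
    hmarkov a b (Finset.mem_compl.mp hb)).trans
      (Finset.sum_le_univ_sum_of_nonneg (hterm a))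

theorem infoMoment_prod (hP : ∀ a, 0 ≤ P a) (hV : ∀ a b, 0 ≤ V a b) (n : ℕ) (t : ℝ) :
    infoMoment (prodDist P n) (prodChannel V n) t = infoMoment P V t ^ n := by
  have hratio : ∀ a b, 0 ≤ V a b / outDist P V b := fun a b =>
    div_nonneg (hV a b) (outDist_nonneg hP hV b)
  calc infoMoment (prodDist P n) (prodChannel V n) t
      = ∑ x : Fin n → A, ∑ y : Fin n → B,
          ∏ i, P (x i) * V (x i) (y i) * (V (x i) (y i) / outDist P V (y i)) ^ (-t) := by
        simp only [infoMoment, outDist_prodDist_prodChannel]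
        refine Finset.sum_congr rfl fun x _ => Finset.sum_congr rfl fun y _ => ?_
        rw [prodDist, prodChannel, prodDist, ← Finset.prod_div_distrib,
          ← Real.finsetProd_rpow _ _ fun i _ => hratio (x i) (y i), ← Finset.prod_mul_distrib,
          ← Finset.prod_mul_distrib]
    _ = ∑ x : Fin n → A,
          ∏ i, ∑ b, P (x i) * V (x i) b * (V (x i) b / outDist P V b) ^ (-t) :=
        Finset.sum_congr rfl fun x _ => (Fintype.prod_sum fun i b =>
          P (x i) * V (x i) b * (V (x i) b / outDist P V b) ^ (-t)).symm
    _ = infoMoment P V t ^ n := by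
        rw [← Fintype.prod_sum fun _ a => ∑ b, P a * V a b * (V a b / outDist P V b) ^ (-t)]
        simp [infoMoment]

theorem infoMoment_zero (hP : ∑ a, P a = 1) (hV : ∀ a, ∑ b, V a b = 1) :
    infoMoment P V 0 = 1 := by
  simp [infoMoment, ← Finset.mul_sum, hV, hP]

theorem hasDerivAt_infoMoment (hP : ∀ a, 0 ≤ P a) (hV : ∀ a b, 0 ≤ V a b) :
    HasDerivAt (infoMoment P V) (-(mutualInfo P V * Real.log 2)) 0 := by
  have hsum : -(mutualInfo P V * Real.log 2) =
      ∑ a, ∑ b, -(P a * V a b * Real.log (V a b / outDist P V b)) := by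
    simp only [mutualInfo_mul_log_two, relEntropy, Finset.mul_sum, mul_assoc,
      Finset.sum_neg_distrib]
  rw [hsum]
  refine HasDerivAt.fun_sum fun a _ => HasDerivAt.fun_sum fun b _ => ?_
  rcases eq_or_ne (P a * V a b) 0 with hab | hab
  · simpa [hab] using hasDerivAt_const (0 : ℝ) (0 : ℝ)
  · exact (((hasDerivAt_neg (0 : ℝ)).const_rpow (div_outDist_pos hP hV hab)).const_mul
      (P a * V a b)).congr_deriv (by simp)

theorem exists_rpow_mul_infoMoment_lt_one (hP : P ∈ stdSimplex ℝ A)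
    (hV : ∀ a, V a ∈ stdSimplex ℝ B) {R : ℝ} (hR : R < mutualInfo P V) :
    ∃ t, 0 ≤ t ∧ ((2 : ℝ) ^ R) ^ t * infoMoment P V t < 1 := by
  let F : ℝ → ℝ := fun t => ((2 : ℝ) ^ R) ^ t * infoMoment P V t
  have hF0 : F 0 = 1 := by simp [F, infoMoment_zero hP.2 fun a => (hV a).2]
  have hderiv : HasDerivAt F ((R - mutualInfo P V) * Real.log 2) 0 := by
    refine (((hasDerivAt_id (0 : ℝ)).const_rpow (Real.rpow_pos_of_pos two_pos R)).mul
      (hasDerivAt_infoMoment hP.1 fun a => (hV a).1)).congr_deriv ?_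
    simp [infoMoment_zero hP.2 fun a => (hV a).2, Real.log_rpow two_pos]
    ring
  have hneg : (R - mutualInfo P V) * Real.log 2 < 0 :=
    mul_neg_of_neg_of_pos (sub_neg.mpr hR) (Real.log_pos one_lt_two)
  obtain ⟨t, hslope, ht⟩ := ((hderiv.tendsto_slope_zero_right.eventually_lt_const hneg).and
    self_mem_nhdsWithin).exists
  refine ⟨t, le_of_lt ht, ?_⟩
  rw [zero_add, hF0, smul_eq_mul] at hslope
  exact sub_neg.mp (neg_of_mul_neg_right hslope (inv_nonneg.mpr (le_of_lt ht)))

end InformationDensity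

section Codebooks

variable {A B : Type*} [Fintype B] {V : A → B → ℝ} {M : ℕ} {γ ε : ℝ}

/-- Every set of inputs of `p`-mass at least `γ` contains a codebook of size `M` with maximal error
probability at most `ε`. -/
def HasCodebooksIn (p : A → ℝ) (V : A → B → ℝ) (M : ℕ) (γ ε : ℝ) : Prop :=
  ∀ S : Finset A, γ ≤ ∑ a ∈ S, p a →
    ∃ (c : Fin M → A) (d : B → Fin M), (∀ m, c m ∈ S) ∧ HasMaxError V ε c d

theorem hasCodebooksIn_one (p : A → ℝ) (V : A → B → ℝ) (hγ : 0 < γ) (hε : 0 ≤ ε) :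
    HasCodebooksIn p V 1 γ ε := by
  intro S hS
  obtain ⟨a, ha⟩ : S.Nonempty := Finset.nonempty_of_sum_ne_zero (hγ.trans_le hS).ne'
  exact ⟨fun _ => a, fun _ => 0, fun _ => ha, fun m => by simpa [Subsingleton.elim _ m] using hε⟩

variable [Fintype A]

theorem eventually_hasCodebooksIn {P : A → ℝ} (hP : P ∈ stdSimplex ℝ A)
    (hV : ∀ a, V a ∈ stdSimplex ℝ B) {R : ℝ} (hR : R < mutualInfo P V) (hγ : 0 < γ) (hε : 0 < ε) :
    ∀ᶠ n : ℕ in atTop,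
      HasCodebooksIn (prodDist P n) (prodChannel V n) ⌈((2 : ℝ) ^ R) ^ n⌉₊ γ ε := by
  obtain ⟨R', hRR', hR'⟩ := exists_between hR
  obtain ⟨t, ht, hlt⟩ := exists_rpow_mul_infoMoment_lt_one hP hV hR'
  have hpow : ∀ r : ℝ, 0 < (2 : ℝ) ^ r := Real.rpow_pos_of_pos two_pos
  set κ := ((2 : ℝ) ^ R') ^ t * infoMoment P V t with hκ
  have hlim : Tendsto (fun n : ℕ => κ ^ n + ((2 : ℝ) ^ R / 2 ^ R') ^ n) atTop (𝓝 0) := by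
    simpa using (tendsto_pow_atTop_nhds_zero_of_lt_one
      (mul_nonneg (Real.rpow_nonneg (hpow R').le t)
        (infoMoment_nonneg hP.1 (fun a => (hV a).1) t)) hlt).add
      (tendsto_pow_atTop_nhds_zero_of_lt_one (div_pos (hpow R) (hpow R')).le
        ((div_lt_one (hpow R')).mpr (Real.rpow_lt_rpow_of_exponent_lt one_lt_two hRR')))
  filter_upwards [hlim.eventually_lt_const (mul_pos hε hγ)] with n hn S hS
  have hθ : 0 < ((2 : ℝ) ^ R') ^ n := pow_pos (hpow R') n
  refine exists_codebook_of_thresholdSet (prodChannel_mem_stdSimplex hV n)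
    (prodDist_mem_stdSimplex hP n).1 hθ (Nat.ceil_pos.mpr (pow_pos (hpow R) n)) ?_
  have htail := sum_compl_thresholdSet_le (prodDist_mem_stdSimplex hP n).1
    (fun x => (prodChannel_mem_stdSimplex hV n x).1) hθ ht
  rw [infoMoment_prod hP.1 fun a => (hV a).1, ← Real.rpow_pow_comm (hpow R').le, ← mul_pow,
    ← hκ] at htail
  have hsize : ((⌈((2 : ℝ) ^ R) ^ n⌉₊ : ℝ) - 1) / ((2 : ℝ) ^ R') ^ n ≤ (2 ^ R / 2 ^ R') ^ n := by
    rw [div_pow]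
    gcongr
    linarith [Nat.ceil_lt_add_one (pow_pos (hpow R) n).le]
  calc _ ≤ κ ^ n + ((2 : ℝ) ^ R / 2 ^ R') ^ n := add_le_add htail hsize
    _ < ε * γ := hn
    _ ≤ ε * ∑ a ∈ S, prodDist P n a := mul_le_mul_of_nonneg_left hS hε.le

end Codebooks

section Resolvability

variable {A B : Type*} [Fintype B] {β γ ε : ℝ}

theorem exists_sum_sq_div_le {J : Type*} {r : J → B → ℝ} (hr : ∀ j, r j ∈ stdSimplex ℝ B)
    {q : B → ℝ} (hβ : 0 < β) (hq : ∀ b, q b ≠ 0 → β ≤ q b) {C : ℝ} (hC : 0 ≤ C)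
    (hnext : ∀ T : B → ℝ, (∀ b, 0 ≤ T b) → ∃ j, ∑ b, T b * r j b / q b ≤ C * ∑ b, T b) (K : ℕ) :
    ∃ j : Fin K → J, ∑ b, (∑ k, r (j k) b) ^ 2 / q b ≤ C * K ^ 2 + K / β := by
  induction K with
  | zero => exact ⟨Fin.elim0, by simp⟩
  | succ K ih =>
    obtain ⟨j, hj⟩ := ih
    obtain ⟨i, hi⟩ := hnext (fun b => ∑ k, r (j k) b)
      fun b => Finset.sum_nonneg fun k _ => (hr (j k)).1 b
    have hmass : ∑ b, ∑ k, r (j k) b = K := by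
      rw [Finset.sum_comm]
      simp [(hr _).2]
    have hsq : ∑ b, r i b ^ 2 / q b ≤ 1 / β := by
      rw [← (hr i).2, Finset.sum_div]
      refine Finset.sum_le_sum fun b _ => ?_
      have hr1 : r i b ≤ 1 := (mem_Icc_of_mem_stdSimplex (hr i) b).2
      rcases eq_or_ne (q b) 0 with hb | hb
      · simpa [hb] using div_nonneg ((hr i).1 b) hβ.le
      · exact div_le_div₀ ((hr i).1 b) (pow_le_of_le_one ((hr i).1 b) hr1 two_ne_zero) hβ (hq b hb)
    refine ⟨Fin.cons i j, ?_⟩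
    calc ∑ b, (∑ k, r (Fin.cons (α := fun _ => J) i j k) b) ^ 2 / q b
        = ∑ b, (∑ k, r (j k) b) ^ 2 / q b + 2 * ∑ b, (∑ k, r (j k) b) * r i b / q b
            + ∑ b, r i b ^ 2 / q b := by
          simp only [Fin.sum_univ_succ, Fin.cons_zero, Fin.cons_succ, Finset.mul_sum (a := (2 : ℝ)),
            ← Finset.sum_add_distrib]
          exact Finset.sum_congr rfl fun b _ => by ring
      _ ≤ (C * K ^ 2 + K / β) + 2 * (C * K) + 1 / β := by
          rw [hmass] at hi
          linarith
      _ ≤ C * (K + 1 : ℕ) ^ 2 + (K + 1 : ℕ) / β := by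
          push_cast
          rw [add_div]
          linarith

variable [Fintype A] {p : A → ℝ} {V : A → B → ℝ}

open Classical in
theorem le_sum_filter_of_sum_mul_le (hp : p ∈ stdSimplex ℝ A) {g : A → ℝ} (hg : ∀ a, 0 ≤ g a)
    (hγ : γ < 1) {τ : ℝ} (hτ : ∑ a, p a * g a ≤ (1 - γ) * τ) :
    γ ≤ ∑ a with p a ≠ 0 ∧ g a ≤ τ, p a := by
  by_contra! hlt
  have hcompl : ∑ a with ¬(p a ≠ 0 ∧ g a ≤ τ), p a = ∑ a with p a ≠ 0 ∧ τ < g a, p a := by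
    refine (Finset.sum_subset (fun a ha => ?_) fun a ha ha' => ?_).symm
    · simp only [Finset.mem_filter, Finset.mem_univ, true_and, not_and, not_le] at ha ⊢
      exact fun _ => ha.2
    · simp only [Finset.mem_filter, Finset.mem_univ, true_and, not_and, not_le] at ha ha'
      by_contra hpa
      exact ha' hpa (ha hpa)
  have hbad : 1 - γ < ∑ a with p a ≠ 0 ∧ τ < g a, p a := by
    linarith [Finset.sum_filter_add_sum_filter_not Finset.univ (fun a => p a ≠ 0 ∧ g a ≤ τ) p,
      hp.2]
  have hτ0 : 0 ≤ τ := nonneg_of_mul_nonneg_right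
    ((Finset.sum_nonneg fun a _ => mul_nonneg (hp.1 a) (hg a)).trans hτ) (sub_pos.mpr hγ)
  have hmarkov : (∑ a with p a ≠ 0 ∧ τ < g a, p a) * τ < ∑ a with p a ≠ 0 ∧ τ < g a, p a * g a := by
    rw [Finset.sum_mul]
    refine Finset.sum_lt_sum_of_nonempty ?_ fun a ha => ?_
    · exact Finset.nonempty_of_sum_ne_zero ((sub_pos.mpr hγ).trans hbad).ne'
    · obtain ⟨hpa, hga⟩ := (Finset.mem_filter.mp ha).2
      exact mul_lt_mul_of_pos_left hga ((hp.1 a).lt_of_ne' hpa)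
  have hsub : ∑ a with p a ≠ 0 ∧ τ < g a, p a * g a ≤ ∑ a, p a * g a :=
    Finset.sum_le_univ_sum_of_nonneg fun a => mul_nonneg (hp.1 a) (hg a)
  linarith [mul_le_mul_of_nonneg_right hbad.le hτ0]

end Resolvability

section Codebook

variable {A B ι : Type*} [Fintype ι] {V : A → B → ℝ}

/-- Output distribution of the channel `V` when a uniformly chosen codeword of the codebook `c` is
sent. -/
noncomputable def codebookOutput (V : A → B → ℝ) (c : ι → A) (b : B) : ℝ :=
  𝔼 m, V (c m) b

theorem codebookOutput_mem_stdSimplex [Fintype B] [Nonempty ι] (hV : ∀ a, V a ∈ stdSimplex ℝ B)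
    (c : ι → A) : codebookOutput V c ∈ stdSimplex ℝ B := by
  refine ⟨fun b => Finset.expect_nonneg fun m _ => (hV (c m)).1 b, ?_⟩
  simp only [codebookOutput, ← Finset.expect_sum_comm, (hV _).2]
  exact Fintype.expect_const 1

theorem codebookOutput_eq_zero_iff (hV : ∀ a b, 0 ≤ V a b) {c : ι → A} {b : B} :
    codebookOutput V c b = 0 ↔ ∀ m, V (c m) b = 0 := by
  rw [codebookOutput, Fintype.expect_eq_zero_iff_of_nonneg fun m => hV (c m) b, funext_iff]
  rfl

theorem codebookOutput_prod {κ : Type*} [Fintype κ] (V : A → B → ℝ) (c : ι → κ → A) (b : B) :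
    codebookOutput V (fun i : ι × κ => c i.1 i.2) b =
      𝔼 k, codebookOutput V (fun i => c i k) b := by
  simp only [codebookOutput, ← Finset.univ_product_univ]
  rw [Finset.expect_product' Finset.univ Finset.univ fun i k => V (c i k) b]
  exact Finset.expect_comm _ _ _

end Codebook

section CovertCode

variable {A B : Type*} [Fintype A] [Fintype B] {p : A → ℝ} {V : A → B → ℝ} {M K : ℕ}
  {β γ δ ε : ℝ}

theorem HasCodebooksIn.exists_sum_mul_div_le (hgood : HasCodebooksIn p V M γ ε)
    (hp : p ∈ stdSimplex ℝ A) (hV : ∀ a b, 0 ≤ V a b) (hM : 0 < M) (hγ : γ < 1) {T : B → ℝ}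
    (hT : ∀ b, 0 ≤ T b) :
    ∃ (c : Fin M → A) (d : B → Fin M), (∀ m, p (c m) ≠ 0) ∧ HasMaxError V ε c d ∧
      ∑ b, T b * codebookOutput V c b / outDist p V b ≤ 1 / (1 - γ) * ∑ b, T b := by
  have hq := outDist_nonneg hp.1 hV
  let g : A → ℝ := fun a => ∑ b, V a b * (T b / outDist p V b)
  have hg : ∀ a, 0 ≤ g a := fun a =>
    Finset.sum_nonneg fun b _ => mul_nonneg (hV a b) (div_nonneg (hT b) (hq b))
  have hmean : ∑ a, p a * g a ≤ ∑ b, T b := by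
    rw [sum_mul_sum_eq_sum_outDist_mul]
    refine Finset.sum_le_sum fun b _ => ?_
    rcases eq_or_ne (outDist p V b) 0 with hb | hb
    · simpa [hb] using hT b
    · exact (mul_div_cancel₀ _ hb).le
  obtain ⟨c, d, hc, hd⟩ := hgood _ (le_sum_filter_of_sum_mul_le hp hg hγ
    (τ := 1 / (1 - γ) * ∑ b, T b) (by field_simp [sub_ne_zero.mpr hγ.ne']; exact hmean))
  have hc' := fun m => (Finset.mem_filter.mp (hc m)).2
  refine ⟨c, d, fun m => (hc' m).1, hd, ?_⟩
  have : Nonempty (Fin M) := ⟨⟨0, hM⟩⟩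
  calc ∑ b, T b * codebookOutput V c b / outDist p V b
      = 𝔼 m, g (c m) := by
        simp only [g, codebookOutput, Finset.expect_sum_comm, Finset.mul_expect, Finset.expect_div]
        exact Finset.sum_congr rfl fun b _ => Finset.expect_congr rfl fun m _ => by ring
    _ ≤ 1 / (1 - γ) * ∑ b, T b := Finset.expect_le Finset.univ_nonempty fun m _ => (hc' m).2

/-- One-shot covert code: `M` messages and `K` keys over the channel `V`, with maximal error
probability at most `ε` under every key and output divergence from `q` at most `δ` bits. -/
def HasCovertCode (V : A → B → ℝ) (q : B → ℝ) (M K : ℕ) (ε δ : ℝ) : Prop :=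
  ∃ (enc : Fin M → Fin K → A) (dec : B → Fin K → Fin M),
    (∀ k, HasMaxError V ε (fun m => enc m k) (fun b => dec b k)) ∧
      klDivergence (codebookOutput V fun i : Fin M × Fin K => enc i.1 i.2) q ≤ (δ : EReal)

theorem HasCodebooksIn.hasCovertCode (hgood : HasCodebooksIn p V M γ ε)
    (hp : p ∈ stdSimplex ℝ A) (hV : ∀ a, V a ∈ stdSimplex ℝ B) (hM : 0 < M) (hK : 0 < K)
    (hγ : γ < 1) (hβ : 0 < β) (hq : ∀ b, outDist p V b ≠ 0 → β ≤ outDist p V b)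
    (hδ : 1 / (1 - γ) + 1 / (β * K) ≤ (2 : ℝ) ^ δ) :
    HasCovertCode V (outDist p V) M K ε δ := by
  have : Nonempty (Fin M) := ⟨⟨0, hM⟩⟩
  have : Nonempty (Fin K) := ⟨⟨0, hK⟩⟩
  obtain ⟨j, hj⟩ := exists_sum_sq_div_le
    (J := {c : Fin M → A // (∀ m, p (c m) ≠ 0) ∧ ∃ d, HasMaxError V ε c d})
    (r := fun c => codebookOutput V c.1) (C := 1 / (1 - γ))
    (fun c => codebookOutput_mem_stdSimplex hV c.1) hβ hq
    (one_div_nonneg.mpr (sub_nonneg.mpr hγ.le)) (fun T hT => by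
      obtain ⟨c, d, hc, hd, hsum⟩ :=
        hgood.exists_sum_mul_div_le hp (fun a => (hV a).1) hM hγ hT
      exact ⟨⟨c, hc, d, hd⟩, hsum⟩) K
  choose d hd using fun k => (j k).2.2
  refine ⟨fun m k => (j k).1 m, fun b k => d k b, hd, klDivergence_le_coe_iff.mpr ?_⟩
  have hac : ∀ b, outDist p V b = 0 →
      codebookOutput V (fun i : Fin M × Fin K => (j i.2).1 i.1) b = 0 := fun b hb =>
    (codebookOutput_eq_zero_iff fun a => (hV a).1).mpr fun i =>
      eq_zero_of_outDist_eq_zero hp.1 (fun a => (hV a).1) ((j i.2).2.1 i.1) hb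
  refine ⟨hac, ?_⟩
  rw [← Real.log_rpow two_pos]
  refine relEntropy_le_log_of_sum_sq_div_le (codebookOutput_mem_stdSimplex hV _)
    (outDist_mem_stdSimplex hp hV).1 hac (le_trans ?_ hδ)
  have : (0 : ℝ) < K := Nat.cast_pos.mpr hK
  calc ∑ b, codebookOutput V (fun i : Fin M × Fin K => (j i.2).1 i.1) b ^ 2 / outDist p V b
      = (∑ b, (∑ k, codebookOutput V (j k).1 b) ^ 2 / outDist p V b) / (K : ℝ) ^ 2 := by
        rw [Finset.sum_div]
        refine Finset.sum_congr rfl fun b _ => ?_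
        rw [codebookOutput_prod V fun m k => (j k).1 m, Fintype.expect_eq_sum_div_card,
          Fintype.card_fin, div_pow, div_right_comm]
    _ ≤ (1 / (1 - γ) * (K : ℝ) ^ 2 + K / β) / (K : ℝ) ^ 2 := by gcongr
    _ = 1 / (1 - γ) + 1 / (β * K) := by field_simp

end CovertCode

section Blocks

variable {X Y : Type*}

theorem eventually_inv_natCast_le [Finite Y] {q : Y → ℝ} (hq : ∀ y, 0 ≤ q y) :
    ∀ᶠ C : ℕ in atTop, ∀ y, q y ≠ 0 → (C : ℝ)⁻¹ ≤ q y := by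
  refine eventually_all.mpr fun y => eventually_imp_distrib_left.mpr fun hy => ?_
  exact tendsto_inv_atTop_nhds_zero_nat.eventually_le_const ((hq y).lt_of_ne' hy)

theorem exists_one_div_one_sub_lt_two_rpow {δ : ℝ} (hδ : 0 < δ) :
    ∃ γ : ℝ, 0 < γ ∧ γ < 1 ∧ 1 / (1 - γ) < (2 : ℝ) ^ δ := by
  refine ⟨1 - 2 ^ (-(δ / 2)), sub_pos.mpr ?_, sub_lt_self _ (by positivity), ?_⟩
  · exact Real.rpow_lt_one_of_one_lt_of_neg one_lt_two (by linarith)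
  · rw [sub_sub_cancel, Real.rpow_neg two_pos.le, one_div, inv_inv]
    exact Real.rpow_lt_rpow_of_exponent_lt one_lt_two (by linarith)

variable [Fintype X] [Fintype Y]

theorem exists_eventually_hasCovertCode {P : X → ℝ} (hP : P ∈ stdSimplex ℝ X) {V : X → Y → ℝ}
    (hV : ∀ x, V x ∈ stdSimplex ℝ Y) {C : ℕ} (hC0 : 0 < C)
    (hC : ∀ y, outDist P V y ≠ 0 → (C : ℝ)⁻¹ ≤ outDist P V y) {δ : ℝ} (hδ : 0 < δ) (ε : ℝ) :
    ∃ γ > 0, ∀ᶠ K : ℕ in atTop, ∀ n M : ℕ, 0 < M →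
      HasCodebooksIn (prodDist P n) (prodChannel V n) M γ ε →
        HasCovertCode (prodChannel V n) (prodDist (outDist P V) n) M (K * C ^ n) ε δ := by
  obtain ⟨γ, hγ0, hγ1, hγ⟩ := exists_one_div_one_sub_lt_two_rpow hδ
  have hlim : Tendsto (fun K : ℕ => 1 / (1 - γ) + 1 / (K : ℝ)) atTop (𝓝 (1 / (1 - γ) + 0)) :=
    tendsto_const_nhds.add tendsto_one_div_atTop_nhds_zero_nat
  rw [add_zero] at hlim
  refine ⟨γ, hγ0, ?_⟩
  filter_upwards [hlim.eventually_le_const hγ, eventually_gt_atTop 0] with K hK hK0 n M hM hgood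
  have hC' : (0 : ℝ) < C := Nat.cast_pos.mpr hC0
  have hkeys : (C : ℝ)⁻¹ ^ n * (K * C ^ n : ℕ) = K := by
    rw [Nat.cast_mul, Nat.cast_pow, mul_left_comm, ← mul_pow, inv_mul_cancel₀ hC'.ne', one_pow,
      mul_one]
  rw [← outDist_prodDist_prodChannel]
  refine hgood.hasCovertCode (prodDist_mem_stdSimplex hP n) (prodChannel_mem_stdSimplex hV n) hM
    (Nat.mul_pos hK0 (pow_pos hC0 n)) hγ1 (pow_pos (inv_pos.mpr hC') n) ?_ (by rwa [hkeys])
  rw [outDist_prodDist_prodChannel]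
  exact pow_le_prodDist (inv_nonneg.mpr hC'.le) hC n

end Blocks

section Codes

variable {X Y : Type*} {n M K : ℕ}

theorem Code.output_eq_codebookOutput (c : Code X Y n M K) (W : Fin 2 → X → Y → ℝ) (s : Fin 2) :
    c.output W s =
      codebookOutput (prodChannel (W s) n) fun i : Fin M × Fin K => c.enc s i.1 i.2 := by
  funext y
  rw [Code.output, codebookOutput, Fintype.expect_eq_sum_div_card, Fintype.sum_prod_type]
  simp [div_eq_inv_mul]

variable [Fintype Y]

theorem Code.forall_errorProb_le_iff (c : Code X Y n M K) (W : Fin 2 → X → Y → ℝ) (s : Fin 2)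
    (k : Fin K) (ε : ℝ) :
    (∀ m, c.errorProb W s k m ≤ ε) ↔
      HasMaxError (prodChannel (W s) n) ε (fun m => c.enc s m k) (fun y => c.dec s y k) := by
  simp only [HasMaxError, Code.errorProb, Finset.sum_filter]

theorem exists_isKLCode_iff {W : Fin 2 → X → Y → ℝ} {Q₀ : Y → ℝ} {ε : ℝ} {δ : Fin 2 → ℝ} :
    (∃ c : Code X Y n M K, c.IsKLCode W Q₀ ε δ) ↔
      ∀ s, HasCovertCode (prodChannel (W s) n) (prodDist Q₀ n) M K ε (δ s) := by
  simp only [Code.IsKLCode, Code.forall_errorProb_le_iff, Code.output_eq_codebookOutput]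
  constructor
  · rintro ⟨c, herr, hdiv⟩ s
    exact ⟨c.enc s, c.dec s, herr s, hdiv s⟩
  · intro h
    choose enc dec herr hdiv using h
    exact ⟨⟨enc, dec⟩, herr, hdiv⟩

end Codes

section Rates

theorem le_liminf_logb_div_rpow_one {M : ℕ → ℕ} {R : ℝ}
    (h : ∀ᶠ n in atTop, ((2 : ℝ) ^ R) ^ n ≤ M n) :
    (R : EReal) ≤
      liminf (fun n : ℕ => ((Real.logb 2 (M n) / (n : ℝ) ^ (1 : ℝ) : ℝ) : EReal)) atTop := by
  refine le_liminf_of_le (by isBoundedDefault) ?_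
  filter_upwards [h, eventually_gt_atTop 0] with n hn hn0
  rw [EReal.coe_le_coe_iff, Real.rpow_one, le_div_iff₀ (Nat.cast_pos.mpr hn0)]
  have hlog := Real.logb_le_logb_of_le one_lt_two (by positivity) hn
  rwa [Real.logb_pow, Real.logb_rpow two_pos (by norm_num), mul_comm] at hlog

theorem limsup_logb_mul_pow_div_rpow_one_le {K C : ℕ} (hK : 0 < K) (hC : 0 < C) :
    limsup (fun n : ℕ => ((Real.logb 2 (K * C ^ n : ℕ) / (n : ℝ) ^ (1 : ℝ) : ℝ) : EReal)) atTop ≤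
      (Real.logb 2 C : ℝ) := by
  have hlim : Tendsto (fun n : ℕ => Real.logb 2 K / n + Real.logb 2 C) atTop
      (𝓝 (0 + Real.logb 2 C)) :=
    (tendsto_const_div_atTop_nhds_zero_nat _).add tendsto_const_nhds
  rw [zero_add] at hlim
  refine ((((continuous_coe_real_ereal.tendsto _).comp hlim).congr' ?_).limsup_eq).le
  filter_upwards [eventually_gt_atTop 0] with n hn
  have hn' : (n : ℝ) ≠ 0 := Nat.cast_ne_zero.mpr hn.ne'
  have hK' : (K : ℝ) ≠ 0 := Nat.cast_ne_zero.mpr hK.ne'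
  have hC' : (C : ℝ) ^ n ≠ 0 := pow_ne_zero _ (Nat.cast_ne_zero.mpr hC.ne')
  rw [Function.comp_apply, EReal.coe_eq_coe_iff, Nat.cast_mul, Nat.cast_pow,
    Real.logb_mul hK' hC', Real.logb_pow, Real.rpow_one, add_div, mul_div_cancel_left₀ _ hn']

end Rates

section Achievability

variable {X Y : Type*} [Fintype X] [Fintype Y] {W : Fin 2 → X → Y → ℝ} {Q₀ : Y → ℝ}
  {P : Fin 2 → X → ℝ} {ε R : ℝ}

theorem exists_messageCounts (hP : ∀ s, P s ∈ stdSimplex ℝ X)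
    (hW : ∀ s x, W s x ∈ stdSimplex ℝ Y) (hR : ∀ s, R < mutualInfo (P s) (W s))
    {γ : Fin 2 → ℝ} (hγ : ∀ s, 0 < γ s) (hε : 0 < ε) :
    ∃ M : ℕ → ℕ, (∀ n, 0 < M n) ∧
      (∀ n s, HasCodebooksIn (prodDist (P s) n) (prodChannel (W s) n) (M n) (γ s) ε) ∧
      ∀ᶠ n in atTop, ((2 : ℝ) ^ R) ^ n ≤ M n := by
  classical
  let good (n M : ℕ) : Prop :=
    ∀ s, HasCodebooksIn (prodDist (P s) n) (prodChannel (W s) n) M (γ s) ε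
  let M₀ (n : ℕ) : ℕ := ⌈((2 : ℝ) ^ R) ^ n⌉₊
  have hone (n : ℕ) : good n 1 := fun s => hasCodebooksIn_one _ _ (hγ s) hε.le
  have hgood : ∀ᶠ n in atTop, good n (M₀ n) :=
    eventually_all.mpr fun s => eventually_hasCodebooksIn (hP s) (hW s) (hR s) (hγ s) hε
  refine ⟨fun n => if good n (M₀ n) then M₀ n else 1, fun n => ?_, fun n => ?_, ?_⟩
  · have : 0 < M₀ n := Nat.ceil_pos.mpr (by positivity)
    dsimp only
    split_ifs <;> omega
  · dsimp only
    split_ifs with h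
    exacts [h, hone n]
  · filter_upwards [hgood] with n hn
    rw [if_pos hn]
    exact Nat.le_ceil _

theorem exists_isAchievable_of_lt_mutualInfo (hW : ∀ s x, W s x ∈ stdSimplex ℝ Y)
    (hP : P ∈ maskingPairs W Q₀) (hε : 0 < ε) {δ : Fin 2 → ℝ} (hδ : ∀ s, 0 < δ s)
    (hR : ∀ s, R < mutualInfo (P s) (W s)) :
    ∃ LK : ℝ, 0 ≤ LK ∧ IsAchievable W Q₀ 1 ε δ (max R 0) (LK : EReal) := by
  have hQ : ∀ s, outDist (P s) (W s) = Q₀ := fun s => funext (hP.2 s)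
  have hQ0 : ∀ y, 0 ≤ Q₀ y := hQ 0 ▸ (outDist_mem_stdSimplex (hP.1 0) (hW 0)).1
  obtain ⟨C, hC, hC0⟩ := ((eventually_inv_natCast_le hQ0).and (eventually_gt_atTop 0)).exists
  choose γ hγ hcovert using fun s => exists_eventually_hasCovertCode (hP.1 s) (hW s) hC0
    (by rwa [hQ s]) (hδ s) ε
  obtain ⟨K, hK, hK0⟩ := ((eventually_all.mpr hcovert).and (eventually_gt_atTop 0)).exists
  obtain ⟨M, hM0, hM, hMR⟩ := exists_messageCounts hP.1 hW hR hγ hε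
  choose c hc using fun n => exists_isKLCode_iff.mpr fun s => hQ s ▸ hK s n (M n) (hM0 n) (hM n s)
  refine ⟨Real.logb 2 C, Real.logb_nonneg one_lt_two (Nat.one_le_cast.mpr hC0), M,
    fun n => K * C ^ n, c, fun n => ⟨hM0 n, Nat.mul_pos hK0 (pow_pos hC0 n), hc n⟩, ?_,
    limsup_logb_mul_pow_div_rpow_one_le hK0 hC0⟩
  rcases max_choice R 0 with h | h <;> rw [h]
  · exact le_liminf_logb_div_rpow_one hMR
  · exact le_liminf_logb_div_rpow_one (Eventually.of_forall fun n => by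
      simpa using Nat.succ_le_of_lt (hM0 n))

end Achievability

section MetaConverse

variable {A B ι : Type*} [Fintype B] [Fintype ι] {V : A → B → ℝ} {q : B → ℝ} {ε : ℝ}

open Classical in
theorem HasMaxError.one_sub_mul_log_card_le [Nonempty ι] {c : ι → A} {d : B → ι}
    (h : HasMaxError V ε c d) (hV : ∀ a, V a ∈ stdSimplex ℝ B) (hq : q ∈ stdSimplex ℝ B)
    (hac : ∀ m b, q b = 0 → V (c m) b = 0) :
    (1 - ε) * Real.log (Fintype.card ι) ≤ 𝔼 m, relEntropy (V (c m)) q + 1 := by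
  have hcard : (1 : ℝ) ≤ Fintype.card ι := Nat.one_le_cast.mpr Fintype.card_pos
  have hmessage : ∀ m, (1 - ε) * Real.log (Fintype.card ι) ≤
      relEntropy (V (c m)) q + (∑ b with d b = m, q b) * Fintype.card ι := fun m => by
    have hsuccess : 1 - ε ≤ ∑ b with d b = m, V (c m) b := by
      linarith [h m, (hV (c m)).2,
        Finset.sum_filter_add_sum_filter_not Finset.univ (fun b => d b = m) (V (c m))]
    have hevent := sum_mul_le_relEntropy_add_sum_mul_exp (hV (c m)) hq (hac m) {b | d b = m}
      (Real.log (Fintype.card ι))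
    rw [Real.exp_log (one_pos.trans_le hcard)] at hevent
    exact (mul_le_mul_of_nonneg_right hsuccess (Real.log_nonneg hcard)).trans hevent
  calc (1 - ε) * Real.log (Fintype.card ι)
      ≤ 𝔼 m, (relEntropy (V (c m)) q + (∑ b with d b = m, q b) * Fintype.card ι) :=
        Finset.le_expect Finset.univ_nonempty fun m _ => hmessage m
    _ = 𝔼 m, relEntropy (V (c m)) q + ∑ m, ∑ b with d b = m, q b := by
        rw [Finset.expect_add_distrib, ← Finset.expect_mul, mul_comm (𝔼 _, _) (_ : ℝ),
          Fintype.card_mul_expect]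
    _ = 𝔼 m, relEntropy (V (c m)) q + 1 := by
        rw [← hq.2, ← Finset.sum_fiberwise Finset.univ d q]

end MetaConverse

section EmpiricalDistribution

variable {X ι : Type*} [Fintype ι]

open Classical in
/-- Empirical distribution of the letters of the word `w`. -/
noncomputable def empiricalDist (w : ι → X) (x : X) : ℝ :=
  𝔼 i, if w i = x then 1 else 0

variable [Fintype X]

open Classical in
theorem sum_empiricalDist_mul (w : ι → X) (f : X → ℝ) :
    ∑ x, empiricalDist w x * f x = 𝔼 i, f (w i) := by
  simp only [empiricalDist, Finset.expect_mul, ← Finset.expect_sum_comm]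
  simp

theorem empiricalDist_mem_stdSimplex [Nonempty ι] (w : ι → X) :
    empiricalDist w ∈ stdSimplex ℝ X := by
  refine ⟨fun x => Finset.expect_nonneg fun i _ => ?_, ?_⟩
  · split_ifs <;> simp
  · simpa using sum_empiricalDist_mul w fun _ => 1

theorem expect_sum_eq_mul_sum_empiricalDist_mul {n : ℕ} (c : ι → Fin n → X) (f : X → ℝ) :
    𝔼 j, ∑ i, f (c j i) =
      n * ∑ x, empiricalDist (fun i : ι × Fin n => c i.1 i.2) x * f x := by
  rw [sum_empiricalDist_mul, ← Finset.univ_product_univ,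
    Finset.expect_product' Finset.univ Finset.univ fun j i => f (c j i), Finset.mul_expect]
  refine Finset.expect_congr rfl fun j _ => ?_
  rw [← Fintype.card_mul_expect, Fintype.card_fin]

end EmpiricalDistribution

section SingleLetter

variable {X Y ι : Type*} [Fintype X] [Fintype Y] [Fintype ι] {V : X → Y → ℝ} {Q : Y → ℝ} {n : ℕ}

theorem expect_relEntropy_prodChannel (hV : ∀ x, V x ∈ stdSimplex ℝ Y) (c : ι → Fin n → X)
    (hac : ∀ j i y, Q y = 0 → V (c j i) y = 0) :
    𝔼 j, relEntropy (prodChannel V n (c j)) (prodDist Q n) =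
      n * ∑ x, empiricalDist (fun i : ι × Fin n => c i.1 i.2) x * relEntropy (V x) Q := by
  rw [← expect_sum_eq_mul_sum_empiricalDist_mul]
  exact Finset.expect_congr rfl fun j _ => relEntropy_pi_prod (fun i => hV (c j i)) (hac j)

theorem sum_codebookOutput_prodChannel_mul_sum (hV : ∀ x, V x ∈ stdSimplex ℝ Y)
    (c : ι → Fin n → X) (h : Y → ℝ) :
    ∑ y, codebookOutput (prodChannel V n) c y * ∑ i, h (y i) =
      n * ∑ y, outDist (empiricalDist fun i : ι × Fin n => c i.1 i.2) V y * h y := by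
  rw [← sum_mul_sum_eq_sum_outDist_mul,
    ← expect_sum_eq_mul_sum_empiricalDist_mul c fun x => ∑ y, V x y * h y]
  simp only [codebookOutput, Finset.expect_mul, ← Finset.expect_sum_comm]
  exact Finset.expect_congr rfl fun j _ =>
    sum_pi_prod_mul_sum (fun i => (hV (c j i)).2) fun _ => h

theorem mul_sum_outDist_empiricalDist_mul_le [Nonempty ι] (hV : ∀ x, V x ∈ stdSimplex ℝ Y)
    (hQ : ∀ y, 0 ≤ Q y) (c : ι → Fin n → X)
    (hac : ∀ y, prodDist Q n y = 0 → codebookOutput (prodChannel V n) c y = 0) (h : Y → ℝ) :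
    n * ∑ y, outDist (empiricalDist fun i : ι × Fin n => c i.1 i.2) V y * h y ≤
      relEntropy (codebookOutput (prodChannel V n) c) (prodDist Q n) +
        n * Real.log (∑ y, Q y * Real.exp (h y)) := by
  have hexp : ∑ y, prodDist Q n y * Real.exp (∑ i, h (y i)) = (∑ y, Q y * Real.exp (h y)) ^ n := by
    simp only [prodDist, Real.exp_sum, ← Finset.prod_mul_distrib]
    rw [← Fintype.prod_sum fun (_ : Fin n) y => Q y * Real.exp (h y)]
    simp
  rw [← sum_codebookOutput_prodChannel_mul_sum hV, ← Real.log_pow, ← hexp]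
  exact sum_mul_le_relEntropy_add_log_sum_mul_exp
    (codebookOutput_mem_stdSimplex (prodChannel_mem_stdSimplex hV n) c)
    (fun y => Finset.prod_nonneg fun i _ => hQ (y i)) hac _

theorem HasCovertCode.exists_input {M K : ℕ} {ε δ : ℝ}
    (h : HasCovertCode (prodChannel V n) (prodDist Q n) M K ε δ) (hn : 0 < n) (hM : 0 < M)
    (hK : 0 < K) (hV : ∀ x, V x ∈ stdSimplex ℝ Y) (hQ : Q ∈ stdSimplex ℝ Y) :
    ∃ P ∈ stdSimplex ℝ X,
      (1 - ε) * Real.log M ≤ n * ∑ x, P x * relEntropy (V x) Q + 1 ∧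
      ∀ f : Y → ℝ, n * ∑ y, outDist P V y * f y ≤
        δ * Real.log 2 + n * Real.log (∑ y, Q y * Real.exp (f y)) := by
  obtain ⟨enc, dec, herr, hdiv⟩ := h
  obtain ⟨hac, hD⟩ := klDivergence_le_coe_iff.mp hdiv
  have := Fin.pos_iff_nonempty.mp hn
  have := Fin.pos_iff_nonempty.mp hM
  have := Fin.pos_iff_nonempty.mp hK
  have hVn := prodChannel_mem_stdSimplex hV n
  have hac' : ∀ (i : Fin M × Fin K) y, prodDist Q n y = 0 →
      prodChannel V n (enc i.1 i.2) y = 0 := fun i y hy =>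
    (codebookOutput_eq_zero_iff fun x => (hVn x).1).mp (hac y hy) i
  refine ⟨empiricalDist fun i : (Fin M × Fin K) × Fin n => enc i.1.1 i.1.2 i.2,
    empiricalDist_mem_stdSimplex _, ?_, fun f => ?_⟩
  · rw [← expect_relEntropy_prodChannel hV (fun i : Fin M × Fin K => enc i.1 i.2) fun i =>
      eq_zero_of_pi_prod_eq_zero (p := fun j => V (enc i.1 i.2 j)) (q := fun _ => Q)
        (fun j => hV (enc i.1 i.2 j)) (hac' i)]
    calc (1 - ε) * Real.log M
        ≤ 𝔼 k, (𝔼 m, relEntropy (prodChannel V n (enc m k)) (prodDist Q n) + 1) :=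
          Finset.le_expect Finset.univ_nonempty fun k _ => by
            simpa using (herr k).one_sub_mul_log_card_le hVn (prodDist_mem_stdSimplex hQ n)
              fun m => hac' (m, k)
      _ = 𝔼 i : Fin M × Fin K, relEntropy (prodChannel V n (enc i.1 i.2)) (prodDist Q n) + 1 := by
          rw [Finset.expect_add_distrib, Fintype.expect_const, Finset.expect_comm,
            ← Finset.univ_product_univ, Finset.expect_product' Finset.univ Finset.univ fun m k =>
              relEntropy (prodChannel V n (enc m k)) (prodDist Q n)]
  · exact (mul_sum_outDist_empiricalDist_mul_le hV hQ.1 _ hac f).trans (add_le_add_left hD _)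

end SingleLetter

section MutualInformation

variable {X Y : Type*} [Fintype X] {P : X → ℝ} {V : X → Y → ℝ}

theorem outDist_eq_of_forall_eq (hP : ∑ x, P x = 1) {p : Y → ℝ} (h : ∀ x, P x ≠ 0 → V x = p) :
    outDist P V = p := by
  funext y
  have hterm : ∀ x, P x * V x y = P x * p y := fun x => by
    rcases eq_or_ne (P x) 0 with hx | hx
    · simp [hx]
    · rw [h x hx]
  simp only [outDist, hterm, ← Finset.sum_mul, hP, one_mul]

variable [Fintype Y]

theorem mutualInfo_pos_iff_exists_ne_outDist (hP : P ∈ stdSimplex ℝ X)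
    (hV : ∀ x, V x ∈ stdSimplex ℝ Y) :
    0 < mutualInfo P V ↔ ∃ x, P x ≠ 0 ∧ V x ≠ outDist P V := by
  have hQ := outDist_mem_stdSimplex hP hV
  have hac : ∀ x, P x ≠ 0 → ∀ y, outDist P V y = 0 → V x y = 0 := fun x hx y =>
    eq_zero_of_outDist_eq_zero hP.1 (fun x => (hV x).1) hx
  have hterm : ∀ x, 0 ≤ P x * relEntropy (V x) (outDist P V) := fun x => by
    rcases eq_or_ne (P x) 0 with hx | hx
    · simp [hx]
    · exact mul_nonneg (hP.1 x) (relEntropy_nonneg (hV x) hQ (hac x hx))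
  rw [← mul_pos_iff_of_pos_right (Real.log_pos one_lt_two), mutualInfo_mul_log_two,
    Finset.sum_pos_iff_of_nonneg fun x _ => hterm x]
  simp only [Finset.mem_univ, true_and]
  refine exists_congr fun x => ?_
  rw [(hterm x).lt_iff_ne', mul_ne_zero_iff]
  exact and_congr_right fun hx => (relEntropy_eq_zero_iff (hV x) hQ (hac x hx)).not

theorem mutualInfo_pos_iff (hP : P ∈ stdSimplex ℝ X) (hV : ∀ x, V x ∈ stdSimplex ℝ Y) :
    0 < mutualInfo P V ↔ ∃ x x', P x ≠ 0 ∧ P x' ≠ 0 ∧ V x ≠ V x' := by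
  rw [mutualInfo_pos_iff_exists_ne_outDist hP hV]
  constructor
  · rintro ⟨x, hx, hne⟩
    by_contra! hall
    exact hne (outDist_eq_of_forall_eq hP.2 fun x' hx' => hall x' x hx' hx).symm
  · rintro ⟨x, x', hx, hx', hne⟩
    by_contra! hall
    exact hne ((hall x hx).trans (hall x' hx').symm)

end MutualInformation

section MaskingCapacity

variable {X Y : Type*} [Fintype X]

/-- Input distributions that turn `V` into the output distribution `Q`: one coordinate of
`maskingPairs`. -/
def maskingInputs (V : X → Y → ℝ) (Q : Y → ℝ) : Set (X → ℝ) :=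
  {P ∈ stdSimplex ℝ X | outDist P V = Q}

theorem maskingPairs_eq_pi (W : Fin 2 → X → Y → ℝ) (Q₀ : Y → ℝ) :
    maskingPairs W Q₀ = Set.univ.pi fun s => maskingInputs (W s) Q₀ := by
  ext P
  simp [maskingPairs, maskingInputs, forall_and, funext_iff]

theorem isCompact_maskingInputs (V : X → Y → ℝ) (Q : Y → ℝ) : IsCompact (maskingInputs V Q) := by
  refine (isCompact_stdSimplex ℝ X).inter_right (isClosed_eq ?_ continuous_const)
  unfold outDist
  fun_prop

variable [Fintype Y]

theorem continuousOn_mutualInfo_maskingInputs (V : X → Y → ℝ) (Q : Y → ℝ) :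
    ContinuousOn (fun P => mutualInfo P V) (maskingInputs V Q) := by
  have hlin : Continuous fun P : X → ℝ => (∑ x, P x * relEntropy (V x) Q) / Real.log 2 := by
    fun_prop
  refine hlin.continuousOn.congr fun P hP => ?_
  rw [eq_div_iff (Real.log_pos one_lt_two).ne', mutualInfo_mul_log_two, hP.2]

/-- Largest mutual information over `V` of an input distribution masked by `Q`; it has the junk
value `0` when there is no such input. -/
noncomputable def maskingCapacity (V : X → Y → ℝ) (Q : Y → ℝ) : ℝ :=
  sSup ((fun P => mutualInfo P V) '' maskingInputs V Q)

theorem isCompact_image_mutualInfo (V : X → Y → ℝ) (Q : Y → ℝ) :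
    IsCompact ((fun P => mutualInfo P V) '' maskingInputs V Q) :=
  (isCompact_maskingInputs V Q).image_of_continuousOn (continuousOn_mutualInfo_maskingInputs V Q)

theorem mutualInfo_le_maskingCapacity {P : X → ℝ} {V : X → Y → ℝ} {Q : Y → ℝ}
    (hP : P ∈ maskingInputs V Q) : mutualInfo P V ≤ maskingCapacity V Q :=
  le_csSup (isCompact_image_mutualInfo V Q).bddAbove (Set.mem_image_of_mem _ hP)

theorem exists_mutualInfo_eq_maskingCapacity {V : X → Y → ℝ} {Q : Y → ℝ}
    (hne : (maskingInputs V Q).Nonempty) :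
    ∃ P ∈ maskingInputs V Q, mutualInfo P V = maskingCapacity V Q :=
  (isCompact_image_mutualInfo V Q).sSup_mem (hne.image _)

variable {W : Fin 2 → X → Y → ℝ} {Q₀ : Y → ℝ}

theorem exists_mem_maskingPairs_mutualInfo_eq (hne : (maskingPairs W Q₀).Nonempty) :
    ∃ P ∈ maskingPairs W Q₀, ∀ s, mutualInfo (P s) (W s) = maskingCapacity (W s) Q₀ := by
  rw [maskingPairs_eq_pi] at hne ⊢
  choose P hP hmax using fun s =>
    exists_mutualInfo_eq_maskingCapacity (Set.univ_pi_nonempty_iff.mp hne s)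
  exact ⟨P, fun s _ => hP s, hmax⟩

theorem isGreatest_maskingCapacity (hne : (maskingPairs W Q₀).Nonempty) (s : Fin 2) :
    IsGreatest ((fun P : Fin 2 → X → ℝ => mutualInfo (P s) (W s)) '' maskingPairs W Q₀)
      (maskingCapacity (W s) Q₀) := by
  obtain ⟨P, hP, hmax⟩ := exists_mem_maskingPairs_mutualInfo_eq hne
  refine ⟨⟨P, hP, hmax s⟩, ?_⟩
  rintro _ ⟨P', hP', rfl⟩
  exact mutualInfo_le_maskingCapacity ⟨hP'.1 s, funext (hP'.2 s)⟩

theorem exists_maskingPairs_forall_ne_iff (hW : ∀ s x, W s x ∈ stdSimplex ℝ Y)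
    (hne : (maskingPairs W Q₀).Nonempty) :
    (∃ P ∈ maskingPairs W Q₀, ∀ s, ∃ x x', P s x ≠ 0 ∧ P s x' ≠ 0 ∧ W s x ≠ W s x') ↔
      ∀ s, 0 < maskingCapacity (W s) Q₀ := by
  constructor
  · rintro ⟨P, hP, hdiff⟩ s
    exact ((mutualInfo_pos_iff (hP.1 s) (hW s)).mpr (hdiff s)).trans_le
      (mutualInfo_le_maskingCapacity ⟨hP.1 s, funext (hP.2 s)⟩)
  · intro hpos
    obtain ⟨P, hP, hmax⟩ := exists_mem_maskingPairs_mutualInfo_eq hne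
    exact ⟨P, hP, fun s => (mutualInfo_pos_iff (hP.1 s) (hW s)).mp (hmax s ▸ hpos s)⟩

end MaskingCapacity

section Converse

variable {X Y : Type*} [Fintype X] [Fintype Y] {V : X → Y → ℝ} {Q : Y → ℝ}

theorem exists_mem_maskingInputs_of_eventually (hQ : ∑ y, Q y = 1) {P : ℕ → X → ℝ}
    (hP : ∀ᶠ n in atTop, P n ∈ stdSimplex ℝ X) {f : X → ℝ} {a : ℕ → ℝ} {r D : ℝ}
    (ha : Tendsto a atTop (𝓝 0)) (hrate : ∀ᶠ n in atTop, r ≤ ∑ x, P n x * f x + a n)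
    (hdist : ∀ h : Y → ℝ, ∀ᶠ n in atTop,
      ∑ y, outDist (P n) V y * h y ≤ D * a n + Real.log (∑ y, Q y * Real.exp (h y))) :
    ∃ P' ∈ maskingInputs V Q, r ≤ ∑ x, P' x * f x := by
  obtain ⟨P', hP', φ, hφ, hlim⟩ := (isCompact_stdSimplex ℝ X).tendsto_subseq' hP.frequently
  have hcomp (g : (X → ℝ) → ℝ) (hg : Continuous g) :
      Tendsto (fun n => g (P (φ n))) atTop (𝓝 (g P')) := (hg.tendsto P').comp hlim
  have haφ := ha.comp hφ.tendsto_atTop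
  refine ⟨P', ⟨hP', eq_of_forall_sum_mul_le_log_sum_mul_exp hQ fun h => ?_⟩, ?_⟩
  · have hright := (haφ.const_mul D).add_const (Real.log (∑ y, Q y * Real.exp (h y)))
    rw [mul_zero, zero_add] at hright
    refine le_of_tendsto_of_tendsto (hcomp (fun p => ∑ y, outDist p V y * h y) ?_) hright
      (hφ.tendsto_atTop.eventually (hdist h))
    unfold outDist
    fun_prop
  · have hright := (hcomp (fun p => ∑ x, p x * f x) (by fun_prop)).add haφ
    rw [add_zero] at hright
    exact ge_of_tendsto hright (hφ.tendsto_atTop.eventually hrate)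

theorem le_maskingCapacity_of_forall_hasCovertCode (hV : ∀ x, V x ∈ stdSimplex ℝ Y)
    (hQ : Q ∈ stdSimplex ℝ Y) {M K : ℕ → ℕ} {ε δ R : ℝ} (hM : ∀ n, 0 < M n) (hK : ∀ n, 0 < K n)
    (hcode : ∀ n, HasCovertCode (prodChannel V n) (prodDist Q n) (M n) (K n) ε δ)
    (hR : ∀ᶠ n in atTop, n * R ≤ (1 - ε) * Real.logb 2 (M n)) :
    R ≤ maskingCapacity V Q := by
  have hlog2 := Real.log_pos one_lt_two
  obtain ⟨P, hP⟩ := ((eventually_gt_atTop 0).mono fun n hn =>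
    (hcode n).exists_input hn (hM n) (hK n) hV hQ).choice
  have hcancel {n : ℕ} (hn : 0 < n) (c z : ℝ) : n * z + c = n * (z + c * (n : ℝ)⁻¹) := by
    field_simp
  have hrate : ∀ᶠ n : ℕ in atTop,
      R * Real.log 2 ≤ ∑ x, P n x * relEntropy (V x) Q + (n : ℝ)⁻¹ := by
    filter_upwards [hP, hR, eventually_gt_atTop 0] with n hn hRn hn0
    have hbits : (1 - ε) * Real.logb 2 (M n) * Real.log 2 = (1 - ε) * Real.log (M n) := by
      rw [mul_assoc, Real.logb, div_mul_cancel₀ _ hlog2.ne']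
    refine le_of_mul_le_mul_left ?_ (Nat.cast_pos.mpr hn0 : (0 : ℝ) < n)
    linarith [hn.2.1, hcancel hn0 1 (∑ x, P n x * relEntropy (V x) Q),
      mul_le_mul_of_nonneg_right hRn hlog2.le]
  have hdist : ∀ h : Y → ℝ, ∀ᶠ n : ℕ in atTop, ∑ y, outDist (P n) V y * h y ≤
      δ * Real.log 2 * (n : ℝ)⁻¹ + Real.log (∑ y, Q y * Real.exp (h y)) := fun h => by
    filter_upwards [hP, eventually_gt_atTop 0] with n hn hn0
    refine le_of_mul_le_mul_left ?_ (Nat.cast_pos.mpr hn0 : (0 : ℝ) < n)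
    linarith [hn.2.2 h, hcancel hn0 (δ * Real.log 2) (Real.log (∑ y, Q y * Real.exp (h y)))]
  obtain ⟨P', hP', hle⟩ := exists_mem_maskingInputs_of_eventually hQ.2 (hP.mono fun n h => h.1)
    tendsto_inv_atTop_nhds_zero_nat hrate hdist
  have hinfo : R ≤ mutualInfo P' V :=
    le_of_mul_le_mul_right (by rwa [mutualInfo_mul_log_two, hP'.2]) hlog2
  exact hinfo.trans (mutualInfo_le_maskingCapacity hP')

end Converse

section Monotonicity

variable {X Y : Type*} [Fintype Y]

theorem IsAchievable.mono_key {W : Fin 2 → X → Y → ℝ} {Q₀ : Y → ℝ} {ζ ε L : ℝ} {δ : Fin 2 → ℝ}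
    {LK LK' : EReal} (h : IsAchievable W Q₀ ζ ε δ L LK) (hle : LK ≤ LK') :
    IsAchievable W Q₀ ζ ε δ L LK' := by
  obtain ⟨M, K, c, hc, hL, hLK⟩ := h
  exact ⟨M, K, c, hc, hL, hLK.trans hle⟩

theorem optThroughput_le_optThroughputInfKey (W : Fin 2 → X → Y → ℝ) (Q₀ : Y → ℝ) (ζ ε : ℝ)
    (δ : Fin 2 → ℝ) : optThroughput W Q₀ ζ ε δ ≤ optThroughputInfKey W Q₀ ζ ε δ := by
  refine sSup_le_sSup ?_
  rintro _ ⟨L, LK, hL, -, rfl, h⟩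
  exact ⟨L, hL, rfl, h.mono_key le_top⟩

end Monotonicity

section Throughput

variable {X Y : Type*} [Fintype X] [Fintype Y] {W : Fin 2 → X → Y → ℝ} {Q₀ : Y → ℝ}
  {ε R : ℝ} {δ : Fin 2 → ℝ}

theorem IsAchievable.one_sub_mul_le_maskingCapacity {L : ℝ} {LK : EReal}
    (h : IsAchievable W Q₀ 1 ε δ L LK) (hW : ∀ s x, W s x ∈ stdSimplex ℝ Y)
    (hQ : Q₀ ∈ stdSimplex ℝ Y) (hε : ε < 1) (s : Fin 2) :
    (1 - ε) * L ≤ maskingCapacity (W s) Q₀ := by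
  obtain ⟨M, K, c, hc, hL, -⟩ := h
  have hε' : 0 < 1 - ε := sub_pos.mpr hε
  rw [mul_comm, ← le_div_iff₀ hε']
  refine le_of_forall_lt_imp_le_of_dense fun L' hL' => ?_
  rw [le_div_iff₀ hε']
  refine le_maskingCapacity_of_forall_hasCovertCode (hW s) hQ (fun n => (hc n).1)
    (fun n => (hc n).2.1) (fun n => exists_isKLCode_iff.mp ⟨c n, (hc n).2.2⟩ s) ?_
  filter_upwards [eventually_lt_of_lt_liminf ((EReal.coe_lt_coe_iff.mpr hL').trans_le hL),
    eventually_gt_atTop 0] with n hn hn0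
  rw [EReal.coe_lt_coe_iff, Real.rpow_one, lt_div_iff₀ (Nat.cast_pos.mpr hn0)] at hn
  nlinarith

theorem exists_isAchievable_of_lt_maskingCapacity (hW : ∀ s x, W s x ∈ stdSimplex ℝ Y)
    (hne : (maskingPairs W Q₀).Nonempty) (hε : 0 < ε) (hδ : ∀ s, 0 < δ s)
    (hR : ∀ s, R < maskingCapacity (W s) Q₀) :
    ∃ LK : ℝ, 0 ≤ LK ∧ IsAchievable W Q₀ 1 ε δ (max R 0) (LK : EReal) := by
  obtain ⟨P, hP, hmax⟩ := exists_mem_maskingPairs_mutualInfo_eq hne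
  exact exists_isAchievable_of_lt_mutualInfo hW hP hε hδ fun s => hmax s ▸ hR s

theorem min_maskingCapacity_le_optThroughput (hW : ∀ s x, W s x ∈ stdSimplex ℝ Y)
    (hne : (maskingPairs W Q₀).Nonempty) (hε : 0 < ε) (hδ : ∀ s, 0 < δ s) :
    ((min (maskingCapacity (W 0) Q₀) (maskingCapacity (W 1) Q₀) : ℝ) : EReal) ≤
      optThroughput W Q₀ 1 ε δ := by
  refine EReal.ge_of_forall_gt_iff_ge.mp fun R hR => ?_
  obtain ⟨LK, hLK, h⟩ := exists_isAchievable_of_lt_maskingCapacity hW hne hε hδ (R := R)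
    (Fin.forall_fin_two.mpr (lt_min_iff.mp (EReal.coe_lt_coe_iff.mp hR)))
  exact (EReal.coe_le_coe_iff.mpr (le_max_left R 0)).trans
    (le_sSup ⟨_, LK, le_max_right R 0, hLK, rfl, h⟩)

theorem optThroughputInfKey_le_min_maskingCapacity_div (hW : ∀ s x, W s x ∈ stdSimplex ℝ Y)
    (hQ : Q₀ ∈ stdSimplex ℝ Y) (hε : ε < 1) :
    optThroughputInfKey W Q₀ 1 ε δ ≤
      ((min (maskingCapacity (W 0) Q₀) (maskingCapacity (W 1) Q₀) / (1 - ε) : ℝ) : EReal) := by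
  refine sSup_le ?_
  rintro _ ⟨L, -, rfl, h⟩
  rw [EReal.coe_le_coe_iff, le_div_iff₀ (sub_pos.mpr hε), mul_comm]
  exact le_min (h.one_sub_mul_le_maskingCapacity hW hQ hε 0)
    (h.one_sub_mul_le_maskingCapacity hW hQ hε 1)

theorem mem_stdSimplex_of_maskingPairs_nonempty (hW : ∀ s x, W s x ∈ stdSimplex ℝ Y)
    (hne : (maskingPairs W Q₀).Nonempty) : Q₀ ∈ stdSimplex ℝ Y := by
  obtain ⟨P, hP⟩ := hne
  exact funext (hP.2 0) ▸ outDist_mem_stdSimplex (hP.1 0) (hW 0)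

theorem exists_pos_forall_isAchievable_iff (hW : ∀ s x, W s x ∈ stdSimplex ℝ Y)
    (hne : (maskingPairs W Q₀).Nonempty) (hδ : ∀ s, 0 < δ s) :
    (∃ L : ℝ, 0 < L ∧ ∀ ε : ℝ, 0 < ε → IsAchievable W Q₀ 1 ε δ L ⊤) ↔
      ∀ s, 0 < maskingCapacity (W s) Q₀ := by
  constructor
  · rintro ⟨L, hL, h⟩ s
    have hhalf := (h (1 / 2) one_half_pos).one_sub_mul_le_maskingCapacity hW
      (mem_stdSimplex_of_maskingPairs_nonempty hW hne) one_half_lt_one s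
    linarith
  · intro hpos
    obtain ⟨L, hL0, hL⟩ := exists_between (lt_min (hpos 0) (hpos 1))
    refine ⟨L, hL0, fun ε hε => ?_⟩
    obtain ⟨LK, -, h⟩ := exists_isAchievable_of_lt_maskingCapacity hW hne hε hδ
      (Fin.forall_fin_two.mpr (lt_min_iff.mp hL))
    exact max_eq_left hL0.le ▸ h.mono_key le_top

end Throughput

theorem tendsto_coe_of_le_of_le_div {f : ℝ → EReal} {C : ℝ} (hlow : ∀ ε, 0 < ε → (C : EReal) ≤ f ε)
    (hup : ∀ ε < 1, f ε ≤ ((C / (1 - ε) : ℝ) : EReal)) :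
    Tendsto f (𝓝[>] 0) (𝓝 (C : EReal)) := by
  have hdiv : ContinuousAt (fun ε : ℝ => C / (1 - ε)) 0 :=
    continuousAt_const.div (continuousAt_const.sub continuousAt_id) (by norm_num)
  have hlim : Tendsto (fun ε : ℝ => ((C / (1 - ε) : ℝ) : EReal)) (𝓝[>] 0) (𝓝 (C : EReal)) := by
    simpa [Function.comp_def] using
      (continuous_coe_real_ereal.continuousAt.comp hdiv).tendsto.mono_left
        (nhdsWithin_le_nhds (s := Set.Ioi (0 : ℝ)))
  refine tendsto_of_tendsto_of_tendsto_of_le_of_le' tendsto_const_nhds hlim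
    (eventually_mem_nhdsWithin.mono hlow) ?_
  exact ((eventually_lt_nhds one_pos).filter_mono nhdsWithin_le_nhds).mono hup

end CompoundCovert

open CompoundCovert in
theorem proposition1_general {X Y : Type*} [Fintype X] [Fintype Y]
    (W : Fin 2 → X → Y → ℝ) (hW : ∀ s x, W s x ∈ stdSimplex ℝ Y)
    (Q₀ : Y → ℝ) (hne : (maskingPairs W Q₀).Nonempty) (δ : Fin 2 → ℝ) (hδ : ∀ s, 0 < δ s) :
    ∃ C : Fin 2 → ℝ,
      (∀ s, IsGreatest ((fun P : Fin 2 → X → ℝ => mutualInfo (P s) (W s)) '' maskingPairs W Q₀)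
        (C s)) ∧
      Filter.Tendsto (fun ε : ℝ => optThroughputInfKey W Q₀ 1 ε δ)
        (nhdsWithin 0 (Set.Ioi 0)) (nhds ((min (C 0) (C 1) : ℝ) : EReal)) ∧
      Filter.Tendsto (fun ε : ℝ => optThroughput W Q₀ 1 ε δ)
        (nhdsWithin 0 (Set.Ioi 0)) (nhds ((min (C 0) (C 1) : ℝ) : EReal)) ∧
      ((∃ P ∈ maskingPairs W Q₀, ∀ s, ∃ x x' : X, P s x ≠ 0 ∧ P s x' ≠ 0 ∧ W s x ≠ W s x') ↔
        ∃ L : ℝ, 0 < L ∧ ∀ ε : ℝ, 0 < ε → IsAchievable W Q₀ 1 ε δ L ⊤) := by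
  have hQ := mem_stdSimplex_of_maskingPairs_nonempty hW hne
  have hlow := fun ε (hε : 0 < ε) => min_maskingCapacity_le_optThroughput hW hne hε hδ
  have hup := fun ε (hε : ε < 1) => optThroughputInfKey_le_min_maskingCapacity_div hW hQ (δ := δ) hε
  have hkey := fun ε => optThroughput_le_optThroughputInfKey W Q₀ 1 ε δ
  exact ⟨fun s => maskingCapacity (W s) Q₀, isGreatest_maskingCapacity hne,
    tendsto_coe_of_le_of_le_div (fun ε hε => (hlow ε hε).trans (hkey ε)) hup,
    tendsto_coe_of_le_of_le_div hlow fun ε hε => (hkey ε).trans (hup ε hε),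
    (exists_maskingPairs_forall_ne_iff hW hne).trans
      (exists_pos_forall_isAchievable_iff hW hne hδ).symm⟩

theorem proposition1 {X Y : Type*} [Fintype X] [Fintype Y]
    (W : Fin 2 → X → Y → ℝ) (hW : ∀ s x, W s x ∈ stdSimplex ℝ Y)
    (Q₀ : Y → ℝ) (hcase : CompoundCovert.IsCase1 W Q₀)
    (δ : Fin 2 → ℝ) (hδ : ∀ s, 0 < δ s) :
    ∃ C : Fin 2 → ℝ,
      (∀ s, IsGreatest
        ((fun P : Fin 2 → X → ℝ => CompoundCovert.mutualInfo (P s) (W s)) ''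
          CompoundCovert.maskingPairs W Q₀) (C s)) ∧
      Filter.Tendsto (fun ε : ℝ => CompoundCovert.optThroughputInfKey W Q₀ 1 ε δ)
        (nhdsWithin 0 (Set.Ioi 0)) (nhds ((min (C 0) (C 1) : ℝ) : EReal)) ∧
      Filter.Tendsto (fun ε : ℝ => CompoundCovert.optThroughput W Q₀ 1 ε δ)
        (nhdsWithin 0 (Set.Ioi 0)) (nhds ((min (C 0) (C 1) : ℝ) : EReal)) ∧
      ((∃ P ∈ CompoundCovert.maskingPairs W Q₀,
          ∀ s, ∃ x x' : X, P s x ≠ 0 ∧ P s x' ≠ 0 ∧ W s x ≠ W s x') ↔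
        ∃ L : ℝ, 0 < L ∧ ∀ ε : ℝ, 0 < ε → CompoundCovert.IsAchievable W Q₀ 1 ε δ L ⊤) :=
  have ⟨P, hP, _⟩ := hcase
  proposition1_general W hW Q₀ ⟨P, hP⟩ δ hδ
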